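/- Fix $c_0>0$, $\alpha>0$, $h>0$ and intervals $(s_0,s_1)$, $(t_0,t_1)$ (end points may be infinite), and put $Y=(s_0,s_1)\times(t_0,t_1)$ with coordinates $(s,t)$ and $X=\mathbb R^2$ with coordinates $x=(x_1,x_2)$, where $x\in X$ is identified with the point $(x_1,x_2,0)\in\mathbb R^3$. Let $\gamma_T(s)=(s+\alpha,0,h)$ and $\gamma_R(s)=(s-\alpha,0,h)$ be the transmitter and receiver trajectories, and write $d_T=|x-\gamma_T(s)|$, $d_R=|x-\gamma_R(s)|$. Let $Y_0=\{(s,t)\in Y: t\neq 2\sqrt{\alpha^2+h^2}/c_0\}$. Let $A(s,t,x,\omega)$ be a smooth complex-valued function on $Y\times X\times\mathbb R$ that is a symbol of order $2$ (for every compact $K\subset Y\times X$ and all $a\in\mathbb N$, $b,c\in\mathbb N^2$ there is $C$ with $|\partial_\omega^{a}\partial_{(s,t)}^{b}\partial_x^{c}A|\le C(1+|\omega|)^{2-a}$ for $(s,t,x)\in K$, $\omega\in\mathbb R$) and that vanishes for $(s,t)$ outside some compact subset of $Y_0$. Let $F$ be the bistatic linearized scattering operator $$FV(s,t)=\int e^{-i\omega\left(t-\frac1{c_0}(d_T+d_R)\right)}A(s,t,x,\omega)\,V(x)\,dx\,d\omega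 ,$$ an oscillatory integral defining a distribution on $Y$ for $V\in C_c^\infty(X)$. For an open set $D\subseteq Y$ let $\Lambda_D\subset T^*D\times T^*X$ be the set of all points $$\Bigl(s,t,-\tfrac{\omega}{c_0}\bigl(\tfrac{x_1-s-\alpha}{d_T}+\tfrac{x_1-s+\alpha}{d_R}\bigr),-\omega;\ x_1,x_2,-\tfrac{\omega}{c_0}\bigl(\tfrac{x_1-s-\alpha}{d_T}+\tfrac{x_1-s+\alpha}{d_R}\bigr),-\tfrac{\omega}{c_0}\bigl(\tfrac{x_2}{d_T}+\tfrac{x_2}{d_R}\bigr)\Bigr)$$ with $(s,t)\in D$, $x\in X$, $\omega\ne0$ and $c_0t=\sqrt{(x_1-s-\alpha)^2+x_2^2+h^2}+\sqrt{(x_1-s+\alpha)^2+x_2^2+h^2}$, and put $\Lambda=\Lambda_Y$. Then: (1) $F$ is a Fourier integral operator of order $3/2$ associated with $\Lambda$: the twisted relation $\Lambda'=\{(y,x;\eta,-\xi):(y,\eta;x,\xi)\in\Lambda\}$ is a closed conic Lagrangian submanifold of $T^*(Y\times X)\setminus0$, and the Schwartz kernel of $F$ lies in H\"ormander's class $I^{3/2}(Y\times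 X,\Lambda')$. The same holds over $Y_0$ with $\Lambda_{Y_0}$, which in addition is contained in $(T^*Y_0\setminus0)\times(T^*X\setminus0)$, so that it is a homogeneous canonical relation. (2) $(x_1,x_2,s,\omega)$ is a global parametrization of $\Lambda$: these coordinates identify $\Lambda$ diffeomorphically with the open set of all $(x_1,x_2,s,\omega)$ with $\omega\neq0$ and $(s,(d_T+d_R)/c_0)\in Y$. (3) The projection $\pi_L:\Lambda\to T^*Y$ is a Whitney fold whose set of critical points is $\Sigma=\{x_2=0\}$: away from $\Sigma$ it is a local diffeomorphism, and at every point of the smooth hypersurface $\Sigma$ it drops rank simply by one (its differential has corank one, and the determinant of its differential has nonzero differential) and $\ker d\pi_L\not\subset T\Sigma$. (4) The projection $\pi_R:\Lambda\to T^*X$ is a blow-down along $\Sigma$: away from $\Sigma$ it is a local diffeomorphism, and at every point of $\Sigma$ it drops rank simply by one, $\ker d\pi_R\subset T\Sigma$, the Hessian $\ker d\pi_R\to\operatorname{coker}d\pi_R$ vanishes, and the fibres of $\pi_R|_\Sigma$ are one-dimensional submanifolds. -/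

import Mathlib

open Set Filter Topology MeasureTheory TopologicalSpace
open scoped Distributions ContDiff

noncomputable section

namespace BistaticSAR

/-! ## Smooth parametrizations and embedded submanifolds of a normed space -/

section Submanifolds

variable {M F : Type*} [NormedAddCommGroup M] [NormedSpace ℝ M]
  [NormedAddCommGroup F] [NormedSpace ℝ F]

/-- `g` is a diffeomorphism of the open set `U` of the vector space `M` onto the embedded `C^∞`
submanifold `S` of `F`: it is smooth, it has image `S`, and it has a left inverse which is smooth on
a neighbourhood of `S` (so `g` is an injective immersion and a homeomorphism onto `S`). -/
def IsSmoothParametrization (g : M → F) (U : Set M) (S : Set F) : Prop :=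
  IsOpen U ∧ ContDiffOn ℝ ∞ g U ∧ g '' U = S ∧
    ∃ (W : Set F) (k : F → M), IsOpen W ∧ S ⊆ W ∧ ContDiffOn ℝ ∞ k W ∧ ∀ u ∈ U, k (g u) = u

variable (M) in
/-- `S` is an embedded `C^∞` submanifold of `F`, of the dimension of `M`. -/
def IsEmbeddedSubmanifold (S : Set F) : Prop :=
  ∀ p ∈ S, ∃ (W : Set F) (U : Set M) (g : M → F),
    IsOpen W ∧ p ∈ W ∧ IsSmoothParametrization g U (S ∩ W)

/-- `ρ` is a regular local defining function of the set `L` at the point `u`. When there is one,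
`L` is a smooth hypersurface at `u`, with tangent space `ker (fderiv ℝ ρ u)`. -/
def IsLocalDefiningFunction (ρ : M → ℝ) (L : Set M) (u : M) : Prop :=
  ∃ W : Set M, IsOpen W ∧ u ∈ W ∧ ContDiffOn ℝ ∞ ρ W ∧ fderiv ℝ ρ u ≠ 0 ∧
    L ∩ W = {w ∈ W | ρ w = 0}

end Submanifolds

/-! ## Folds and blow-downs -/

section Singularities

variable {M F : Type*} [NormedAddCommGroup M] [NormedSpace ℝ M]
  [NormedAddCommGroup F] [NormedSpace ℝ F]

/-- `f` drops rank simply by one at `u`: its differential has corank one there, and the determinant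
of the differential (with respect to linear coordinates) vanishes to first order only. -/
def DropsRankSimplyByOne (f : M → F) (u : M) : Prop :=
  Module.finrank ℝ (LinearMap.range (fderiv ℝ f u).toLinearMap) + 1 = Module.finrank ℝ M ∧
    ∃ e : F ≃L[ℝ] M,
      fderiv ℝ (fun v => ((e : F →L[ℝ] M).comp (fderiv ℝ f v)).det) u ≠ 0

/-- `f`, restricted to the open set `U`, is a Whitney fold whose set of critical points is `L`. -/
def IsWhitneyFold (f : M → F) (U L : Set M) : Prop :=
  IsOpen U ∧ L ⊆ U ∧ ContDiffOn ℝ ∞ f U ∧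
  (∀ u ∈ U \ L,
    IsLocalDiffeomorphAt (modelWithCornersSelf ℝ M) (modelWithCornersSelf ℝ F) ∞ f u) ∧
  ∀ u ∈ L, DropsRankSimplyByOne f u ∧
    ∃ ρ : M → ℝ, IsLocalDefiningFunction ρ L u ∧
      ¬ LinearMap.ker (fderiv ℝ f u).toLinearMap ≤ LinearMap.ker (fderiv ℝ ρ u).toLinearMap

/-- `f`, restricted to the open set `U`, is a blow-down along `L`. The Hessian of `f` at a point of
`L` is the quadratic form on `ker df` with values in `coker df` that is induced by the second
derivative. -/
def IsBlowDown (f : M → F) (U L : Set M) : Prop :=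
  IsOpen U ∧ L ⊆ U ∧ ContDiffOn ℝ ∞ f U ∧
  (∀ u ∈ U \ L,
    IsLocalDiffeomorphAt (modelWithCornersSelf ℝ M) (modelWithCornersSelf ℝ F) ∞ f u) ∧
  ∀ u ∈ L, DropsRankSimplyByOne f u ∧
    (∀ v : M, fderiv ℝ f u v = 0 → fderiv ℝ (fderiv ℝ f) u v v ∈ Set.range (fderiv ℝ f u)) ∧
    (∃ ρ : M → ℝ, IsLocalDefiningFunction ρ L u ∧
      LinearMap.ker (fderiv ℝ f u).toLinearMap ≤ LinearMap.ker (fderiv ℝ ρ u).toLinearMap) ∧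
    IsEmbeddedSubmanifold ℝ {w ∈ L | f w = f u}

end Singularities

/-! ## Conic Lagrangian submanifolds

The cotangent bundle of an open subset of `E` is realised as a subset of `E × StrongDual ℝ E`. -/

section Lagrangian

variable {E : Type*} [NormedAddCommGroup E] [NormedSpace ℝ E]

/-- The canonical symplectic form of `T*E = E × E*`. -/
def symplecticForm (p q : E × StrongDual ℝ E) : ℝ := p.2 q.1 - q.2 p.1

/-- `S` is a closed conic Lagrangian `C^∞` submanifold of `T*Ω` minus the zero section. -/
def IsClosedConicLagrangian (Ω : Opens E) (S : Set (E × StrongDual ℝ E)) : Prop :=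
  (∃ C : Set (E × StrongDual ℝ E), IsClosed C ∧ S = {p ∈ C | p.1 ∈ Ω ∧ p.2 ≠ 0}) ∧
  (∀ p ∈ S, ∀ r : ℝ, 0 < r → (p.1, r • p.2) ∈ S) ∧
  ∀ p ∈ S, ∃ (W : Set (E × StrongDual ℝ E)) (U : Set E) (g : E → E × StrongDual ℝ E),
    IsOpen W ∧ p ∈ W ∧ IsSmoothParametrization g U (S ∩ W) ∧
    ∀ u ∈ U, ∀ v w : E, symplecticForm (fderiv ℝ g u v) (fderiv ℝ g u w) = 0

end Lagrangian

/-! ## Symbols, oscillatory integrals and Lagrangian distributions -/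

section Oscillatory

variable {E W : Type*} [NormedAddCommGroup E] [NormedSpace ℝ E]
  [NormedAddCommGroup W] [NormedSpace ℝ W]

/-- `a` belongs to the symbol class `S^μ_{1,0}(Ω × W)`. -/
def IsSymbol (μ : ℝ) (Ω : Opens E) (a : E × W → ℂ) : Prop :=
  ContDiffOn ℝ ∞ a ((Ω : Set E) ×ˢ univ) ∧
  ∀ L : Set E, IsCompact L → L ⊆ Ω → ∀ j k : ℕ, ∃ C : ℝ, ∀ z ∈ L, ∀ θ : W,
    ‖iteratedFDeriv ℝ j (fun z' => iteratedFDeriv ℝ k (fun θ' => a (z', θ')) θ) z‖ ≤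
      C * (1 + ‖θ‖) ^ (μ - (k : ℝ))

/-- The oscillatory integral `∫∫ e^{iφ(z,θ)} a(z,θ) u(z) dz dθ` exists and is equal to `I`: for
every cutoff `χ ∈ C_c^∞(W)` with `χ(0) = 1` the integrals regularised by `χ(εθ)` tend to `I` as
`ε → 0+`. -/
def HasOscillatoryIntegral [MeasureSpace E] [MeasureSpace W]
    (φ : E × W → ℝ) (a : E × W → ℂ) (u : E → ℝ) (I : ℂ) : Prop :=
  ∀ χ : W → ℝ, ContDiff ℝ ∞ χ → HasCompactSupport χ → χ 0 = 1 →
    Tendsto (fun ε : ℝ => ∫ p : E × W,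
        Complex.exp (Complex.I * (φ p : ℂ)) * (χ (ε • p.2) : ℂ) * a p * (u p.1 : ℂ))
      (𝓝[>] 0) (𝓝 I)

/-- `Γ` is an open conic subset of `Ω × (W \ 0)`. -/
def IsOpenCone (Ω : Opens E) (Γ : Set (E × W)) : Prop :=
  IsOpen Γ ∧ (∀ p ∈ Γ, p.1 ∈ Ω ∧ p.2 ≠ 0) ∧ ∀ p ∈ Γ, ∀ r : ℝ, 0 < r → (p.1, r • p.2) ∈ Γ

/-- The differential `d_z φ` of a phase in the space variables. -/
def spaceDifferential (φ : E × W → ℝ) (p : E × W) : StrongDual ℝ E :=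
  (fderiv ℝ φ p).comp (ContinuousLinearMap.inl ℝ E W)

/-- The critical set `{d_θ φ = 0}` of a phase on the cone `Γ`. -/
def criticalSet (φ : E × W → ℝ) (Γ : Set (E × W)) : Set (E × W) :=
  {p ∈ Γ | (fderiv ℝ φ p).comp (ContinuousLinearMap.inr ℝ E W) = 0}

/-- `φ` is a nondegenerate phase function on the open cone `Γ ⊆ Ω × (ℝ^N \ 0)`: real-valued and
smooth, positively homogeneous of degree one in `θ`, with `dφ ≠ 0`, and such that the differentials
of `∂φ/∂θ_1, …, ∂φ/∂θ_N` are linearly independent wherever these functions all vanish. -/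
def IsNondegeneratePhase {N : ℕ} (Ω : Opens E) (φ : E × EuclideanSpace ℝ (Fin N) → ℝ)
    (Γ : Set (E × EuclideanSpace ℝ (Fin N))) : Prop :=
  IsOpenCone Ω Γ ∧ ContDiffOn ℝ ∞ φ Γ ∧
  (∀ p ∈ Γ, ∀ r : ℝ, 0 < r → φ (p.1, r • p.2) = r * φ p) ∧
  (∀ p ∈ Γ, fderiv ℝ φ p ≠ 0) ∧
  ∀ p ∈ criticalSet φ Γ, LinearIndependent ℝ (fun i : Fin N =>
    fderiv ℝ (fun q => fderiv ℝ φ q (0, EuclideanSpace.single i 1)) p)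

/-- On `Γ`, the phase `φ` parametrizes an open piece of `S`: the map `(z, θ) ↦ (z, d_z φ(z, θ))` is a
bijection from the critical set onto a relatively open subset of `S`. -/
def ParametrizesOpenPiece (φ : E × W → ℝ) (Γ : Set (E × W)) (S : Set (E × StrongDual ℝ E)) :
    Prop :=
  InjOn (fun p => (p.1, spaceDifferential φ p)) (criticalSet φ Γ) ∧
  ∃ O : Set (E × StrongDual ℝ E), IsOpen O ∧
    (fun p => (p.1, spaceDifferential φ p)) '' criticalSet φ Γ = S ∩ O

/-- The amplitude `a` is supported in a (relatively) closed cone of `Γ ∪ (Ω × 0)`. -/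
def IsConicallySupportedIn (Ω : Opens E) (a : E × W → ℂ) (Γ : Set (E × W)) : Prop :=
  ∃ T C : Set (E × W), IsClosed C ∧ T = C ∩ ((Ω : Set E) ×ˢ univ) ∧
    (∀ p ∈ T, ∀ r : ℝ, 0 < r → (p.1, r • p.2) ∈ T) ∧
    (∀ p ∈ T, p.2 ≠ 0 → p ∈ Γ) ∧
    ∀ p : E × W, p.1 ∈ Ω → a p ≠ 0 → p ∈ T

/-- `K` is an oscillatory integral with `N` phase variables, of order `m`, whose phase parametrizes
an open piece of `S`. The amplitude has order `m + (n - 2N)/4`, with `n` the dimension of `E`. -/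
def IsOscillatoryPiece [MeasureSpace E] (m : ℝ) (Ω : Opens E) (S : Set (E × StrongDual ℝ E))
    (N : ℕ) (K : 𝓓'(Ω, ℂ)) : Prop :=
  ∃ (φ : E × EuclideanSpace ℝ (Fin N) → ℝ) (a : E × EuclideanSpace ℝ (Fin N) → ℂ)
    (Γ : Set (E × EuclideanSpace ℝ (Fin N))),
    IsNondegeneratePhase Ω φ Γ ∧ ParametrizesOpenPiece φ Γ S ∧
    IsSymbol (m + ((Module.finrank ℝ E : ℝ) - 2 * N) / 4) Ω a ∧
    IsConicallySupportedIn Ω a Γ ∧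
    ∀ u : 𝓓(Ω, ℝ), HasOscillatoryIntegral φ a u (K u)

/-- Hörmander's class `I^m(Ω, S)` of Lagrangian distributions: the locally finite sums of
oscillatory integrals of order `m` whose phases parametrize open pieces of `S`. -/
def IsLagrangianDistribution [MeasureSpace E] (m : ℝ) (Ω : Opens E)
    (S : Set (E × StrongDual ℝ E)) (K : 𝓓'(Ω, ℂ)) : Prop :=
  ∃ Kj : ℕ → 𝓓'(Ω, ℂ),
    (∀ L : Set E, IsCompact L → L ⊆ Ω →
      {j | ∃ u : 𝓓(Ω, ℝ), tsupport u ⊆ L ∧ Kj j u ≠ 0}.Finite) ∧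
    (∀ u : 𝓓(Ω, ℝ), K u = ∑ᶠ j, Kj j u) ∧
    ∀ j, ∃ N : ℕ, 0 < N ∧ IsOscillatoryPiece m Ω S N (Kj j)

end Oscillatory

/-! ## Fourier integral operators -/

section Operators

variable {E₁ E₂ : Type*} [NormedAddCommGroup E₁] [NormedSpace ℝ E₁]
  [NormedAddCommGroup E₂] [NormedSpace ℝ E₂]

/-- The product of two open sets. -/
def prodOpens (Y : Opens E₁) (X : Opens E₂) : Opens (E₁ × E₂) :=
  ⟨(Y : Set E₁) ×ˢ (X : Set E₂), Y.isOpen.prod X.isOpen⟩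

/-- The tensor product `(y, x) ↦ u(y) v(x)` of two test functions. -/
def tensor {Y : Opens E₁} {X : Opens E₂} (u : 𝓓(Y, ℝ)) (v : 𝓓(X, ℝ)) :
    𝓓(prodOpens Y X, ℝ) where
  toFun p := u p.1 * v p.2
  contDiff' := (u.contDiff.comp contDiff_fst).mul (v.contDiff.comp contDiff_snd)
  hasCompactSupport' := by
    refine HasCompactSupport.intro (u.hasCompactSupport.prod v.hasCompactSupport) ?_
    intro p hp
    by_cases h1 : p.1 ∈ tsupport u
    · have h2 : p.2 ∉ tsupport v := fun h => hp ⟨h1, h⟩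
      simp [image_eq_zero_of_notMem_tsupport h2]
    · simp [image_eq_zero_of_notMem_tsupport h1]
  tsupport_subset' := by
    have h : tsupport (fun p : E₁ × E₂ => u p.1 * v p.2) ⊆ tsupport u ×ˢ tsupport v := by
      refine closure_minimal ?_ ((isClosed_tsupport _).prod (isClosed_tsupport _))
      intro p hp
      have hp' : u p.1 * v p.2 ≠ 0 := hp
      exact ⟨subset_tsupport _ (left_ne_zero_of_mul hp'),
        subset_tsupport _ (right_ne_zero_of_mul hp')⟩
    exact h.trans (prod_mono u.tsupport_subset v.tsupport_subset)

/-- The twist `C' = {(y, x; η, -ξ) : (y, η; x, ξ) ∈ C}` of a relation `C ⊆ T*Y × T*X`. -/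
def twist (C : Set ((E₁ × StrongDual ℝ E₁) × (E₂ × StrongDual ℝ E₂))) :
    Set ((E₁ × E₂) × StrongDual ℝ (E₁ × E₂)) :=
  (fun q => ((q.1.1, q.2.1), q.1.2.comp (ContinuousLinearMap.fst ℝ E₁ E₂) -
    q.2.2.comp (ContinuousLinearMap.snd ℝ E₁ E₂))) '' C

/-- `C` is a homogeneous canonical relation from `T*X \ 0` to `T*Y \ 0`. -/
def IsHomogeneousCanonicalRelation (Y : Opens E₁) (X : Opens E₂)
    (C : Set ((E₁ × StrongDual ℝ E₁) × (E₂ × StrongDual ℝ E₂))) : Prop :=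
  (∀ q ∈ C, q.1.2 ≠ 0 ∧ q.2.2 ≠ 0) ∧ IsClosedConicLagrangian (prodOpens Y X) (twist C)

/-- `F` is a Fourier integral operator of order `m` associated with `C`: the twist `C'` is a closed
conic Lagrangian submanifold of `T*(Y × X) \ 0`, and the Schwartz kernel of `F` belongs to
`I^m(Y × X, C')`. -/
def IsFourierIntegralOperator [MeasureSpace E₁] [MeasureSpace E₂] (m : ℝ)
    (Y : Opens E₁) (X : Opens E₂)
    (C : Set ((E₁ × StrongDual ℝ E₁) × (E₂ × StrongDual ℝ E₂)))
    (F : 𝓓(X, ℝ) →ₗ[ℝ] 𝓓'(Y, ℂ)) : Prop :=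
  IsClosedConicLagrangian (prodOpens Y X) (twist C) ∧
  ∃ K : 𝓓'(prodOpens Y X, ℂ),
    (∀ (V : 𝓓(X, ℝ)) (u : 𝓓(Y, ℝ)), F V u = K (tensor u V)) ∧
    IsLagrangianDistribution m (prodOpens Y X) (twist C) K

end Operators

/-! ## The bistatic model

The data space has the coordinates `(s, t)`, the ground has the coordinates `(x₁, x₂)`, and both are
modelled on `ℝ × ℝ`. -/

/-- The transmitter trajectory. -/
def γT (α h s : ℝ) : EuclideanSpace ℝ (Fin 3) := !₂[s + α, 0, h]

/-- The receiver trajectory. -/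
def γR (α h s : ℝ) : EuclideanSpace ℝ (Fin 3) := !₂[s - α, 0, h]

/-- A point of the ground as a point of space. -/
def ground (x : ℝ × ℝ) : EuclideanSpace ℝ (Fin 3) := !₂[x.1, x.2, 0]

/-- The distance `|x - γ_T(s)|`. -/
def dT (α h s : ℝ) (x : ℝ × ℝ) : ℝ := ‖ground x - γT α h s‖

/-- The distance `|x - γ_R(s)|`. -/
def dR (α h s : ℝ) (x : ℝ × ℝ) : ℝ := ‖ground x - γR α h s‖

/-- The rectangle `(s₀, s₁) × (t₀, t₁)` of the data, with finite or infinite end points. -/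
def dataSpace (s₀ s₁ t₀ t₁ : EReal) : Opens (ℝ × ℝ) where
  carrier := {y | (s₀ < (y.1 : EReal) ∧ (y.1 : EReal) < s₁) ∧
    (t₀ < (y.2 : EReal) ∧ (y.2 : EReal) < t₁)}
  is_open' := by
    have h1 : Continuous fun y : ℝ × ℝ => (y.1 : EReal) :=
      continuous_coe_real_ereal.comp continuous_fst
    have h2 : Continuous fun y : ℝ × ℝ => (y.2 : EReal) :=
      continuous_coe_real_ereal.comp continuous_snd
    exact ((isOpen_lt continuous_const h1).inter (isOpen_lt h1 continuous_const)).inter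
      ((isOpen_lt continuous_const h2).inter (isOpen_lt h2 continuous_const))

/-- The data space without the line `t = 2 √(α² + h²) / c₀` of the travel times to the points
of the ground underneath the midpoint of transmitter and receiver. -/
def excisedDataSpace (c₀ α h : ℝ) (s₀ s₁ t₀ t₁ : EReal) : Opens (ℝ × ℝ) :=
  dataSpace s₀ s₁ t₀ t₁ ⊓
    ⟨{y | y.2 ≠ 2 * √(α ^ 2 + h ^ 2) / c₀}, isOpen_ne_fun continuous_snd continuous_const⟩

/-- The phase `ψ(s, t, x, ω) = -ω (t - (|x - γ_T(s)| + |x - γ_R(s)|) / c₀)`. -/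
def phase (c₀ α h : ℝ) (p : ((ℝ × ℝ) × (ℝ × ℝ)) × ℝ) : ℝ :=
  -p.2 * (p.1.1.2 - 1 / c₀ * (dT α h p.1.1.1 p.1.2 + dR α h p.1.1.1 p.1.2))

/-- The amplitudes `A(s, t, x, ω)` of the model: symbols of order two that vanish for `(s, t)`
outside some compact subset of the excised data space. -/
structure IsAmplitude (c₀ α h : ℝ) (s₀ s₁ t₀ t₁ : EReal)
    (A : ((ℝ × ℝ) × (ℝ × ℝ)) × ℝ → ℂ) : Prop where
  symbol : IsSymbol 2 (prodOpens (dataSpace s₀ s₁ t₀ t₁) (⊤ : Opens (ℝ × ℝ))) A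
  cutoff : ∃ L : Set (ℝ × ℝ), IsCompact L ∧ L ⊆ excisedDataSpace c₀ α h s₀ s₁ t₀ t₁ ∧
    ∀ y ∈ dataSpace s₀ s₁ t₀ t₁, y ∉ L → ∀ (x : ℝ × ℝ) (w : ℝ), A ((y, x), w) = 0

/-- `F` is the operator `F V(s, t) = ∫ e^{iψ(s,t,x,ω)} A(s,t,x,ω) V(x) dx dω` from the test
functions on the ground to the distributions on `D`, the integral being an oscillatory one. -/
def IsForwardOperator (c₀ α h : ℝ) (A : ((ℝ × ℝ) × (ℝ × ℝ)) × ℝ → ℂ) (D : Opens (ℝ × ℝ))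
    (F : 𝓓((⊤ : Opens (ℝ × ℝ)), ℝ) →ₗ[ℝ] 𝓓'(D, ℂ)) : Prop :=
  ∀ (V : 𝓓((⊤ : Opens (ℝ × ℝ)), ℝ)) (u : 𝓓(D, ℝ)),
    HasOscillatoryIntegral (phase c₀ α h) A (fun z => u z.1 * V z.2) (F V u)

/-- The covector with the components `a`, `b`. -/
def covector (a b : ℝ) : StrongDual ℝ (ℝ × ℝ) :=
  a • ContinuousLinearMap.fst ℝ ℝ ℝ + b • ContinuousLinearMap.snd ℝ ℝ ℝ

/-- The relation `Λ` over the set `D` of data points; `w` is the frequency variable `ω`. -/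
def canonicalRelation (c₀ α h : ℝ) (D : Opens (ℝ × ℝ)) :
    Set (((ℝ × ℝ) × StrongDual ℝ (ℝ × ℝ)) × ((ℝ × ℝ) × StrongDual ℝ (ℝ × ℝ))) :=
  {q | ∃ s t x₁ x₂ w : ℝ, (s, t) ∈ D ∧ w ≠ 0 ∧
    c₀ * t = √((x₁ - s - α) ^ 2 + x₂ ^ 2 + h ^ 2) + √((x₁ - s + α) ^ 2 + x₂ ^ 2 + h ^ 2) ∧
    q = (((s, t), covector
            (-(w / c₀) * ((x₁ - s - α) / dT α h s (x₁, x₂) + (x₁ - s + α) / dR α h s (x₁, x₂)))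
            (-w)),
         ((x₁, x₂), covector
            (-(w / c₀) * ((x₁ - s - α) / dT α h s (x₁, x₂) + (x₁ - s + α) / dR α h s (x₁, x₂)))
            (-(w / c₀) * (x₂ / dT α h s (x₁, x₂) + x₂ / dR α h s (x₁, x₂)))))}

/-- The domain of the parameters `((x₁, x₂), (s, ω))` of `Λ`. -/
def parameterDomain (c₀ α h : ℝ) (D : Opens (ℝ × ℝ)) : Set ((ℝ × ℝ) × (ℝ × ℝ)) :=
  {v | (v.2.1, 1 / c₀ * (dT α h v.2.1 v.1 + dR α h v.2.1 v.1)) ∈ D ∧ v.2.2 ≠ 0}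

/-- The point of `Λ` with the parameters `((x₁, x₂), (s, ω))`. -/
def parametrization (c₀ α h : ℝ) (v : (ℝ × ℝ) × (ℝ × ℝ)) :
    ((ℝ × ℝ) × StrongDual ℝ (ℝ × ℝ)) × ((ℝ × ℝ) × StrongDual ℝ (ℝ × ℝ)) :=
  (((v.2.1, 1 / c₀ * (dT α h v.2.1 v.1 + dR α h v.2.1 v.1)), covector
      (-(v.2.2 / c₀) * ((v.1.1 - v.2.1 - α) / dT α h v.2.1 v.1 +
        (v.1.1 - v.2.1 + α) / dR α h v.2.1 v.1))
      (-v.2.2)),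
   (v.1, covector
      (-(v.2.2 / c₀) * ((v.1.1 - v.2.1 - α) / dT α h v.2.1 v.1 +
        (v.1.1 - v.2.1 + α) / dR α h v.2.1 v.1))
      (-(v.2.2 / c₀) * (v.1.2 / dT α h v.2.1 v.1 + v.1.2 / dR α h v.2.1 v.1))))

/-- The projection `π_L` restricted to `Λ`, in the coordinates `((x₁, x₂), (s, ω))`. -/
def piL (c₀ α h : ℝ) (v : (ℝ × ℝ) × (ℝ × ℝ)) : (ℝ × ℝ) × StrongDual ℝ (ℝ × ℝ) :=
  (parametrization c₀ α h v).1

/-- The projection `π_R` restricted to `Λ`, in the coordinates `((x₁, x₂), (s, ω))`. -/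
def piR (c₀ α h : ℝ) (v : (ℝ × ℝ) × (ℝ × ℝ)) : (ℝ × ℝ) × StrongDual ℝ (ℝ × ℝ) :=
  (parametrization c₀ α h v).2

/-- The hypersurface `Σ = {x₂ = 0}` of `Λ`, in the coordinates `((x₁, x₂), (s, ω))`. -/
def singularSet (c₀ α h : ℝ) (D : Opens (ℝ × ℝ)) : Set ((ℝ × ℝ) × (ℝ × ℝ)) :=
  {v ∈ parameterDomain c₀ α h D | v.1.2 = 0}

end BistaticSAR

end

noncomputable section

set_option linter.unusedSectionVars false

namespace BistaticSAR

/-! ## Integration by parts in oscillatory integrals -/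

section Transport

variable {E : Type*} [NormedAddCommGroup E] [NormedSpace ℝ E]

/-! Put `ρ(s,t,x) = (d_T + d_R)/c₀ - t`. The phase is `ω ρ`, and `∂ρ/∂t = -1` everywhere; the
Fourier integral statement rests on these two facts.

Since `∂_t φ = -ω`, the operator `(1 + iω)⁻¹(1 - ∂_t)` fixes `e^{iφ}`. Integrating by parts four
times improves an amplitude of order 2 to decay `|ω|⁻²`, so the regularised integrals converge by
dominated convergence. The limit depends on the test function with order at most four, locally
uniformly, and so defines a distribution on `Y × X` and an operator
(`exists_oscillatory_distribution`, `HasLocalOrderBound.exists_operator`). The twisted relation is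
the conormal bundle of `{ρ = 0}` without its zero section (`twist_canonicalRelation`). It is
therefore closed, conic and Lagrangian, and the single phase `ω ρ` parametrizes all of it. The order
is `2 - (4 - 2)/4 = 3/2`. A ground covector of `Λ` vanishes only for `x₂ = 0`, `x₁ = s`, where the
travel time is the excised value.

For the projections, write `r = d_T + d_R`. In suitable linear coordinates both differentials are
block triangular, with the same determinant `-(ω/c₀²) x₂ Q` (`det_piL`, `det_piR`), and `Q > 0`
because the directions to transmitter and receiver are never opposite (`jacobianFactor_pos`). So
both determinants vanish simply, exactly on `x₂ = 0`. On that hypersurface `∂²r/∂x₁² > 0` forces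
one-dimensional kernels. The kernel of `dπ_L` is spanned by `∂_{x₂}`, transverse to `Σ`: a fold. The
kernel of `dπ_R` lies in the `(s, ω)` plane, tangent to `Σ`. There the fibre fixes `x` and the
product `ω ∂r/∂x₁`, hence is a curve: a blow-down. -/

/-- The first order operator `f ↦ f + ∂_v f`. -/
def addLineDeriv (v : E) (f : E → ℂ) (z : E) : ℂ := f z + fderiv ℝ f z v

lemma contDiff_addLineDeriv (v : E) {f : E → ℂ} (hf : ContDiff ℝ ∞ f) :
    ContDiff ℝ ∞ (addLineDeriv v f) :=
  hf.add ((hf.fderiv_right (m := ∞) (by simp)).clm_apply contDiff_const)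

lemma tsupport_addLineDeriv_subset (v : E) (f : E → ℂ) :
    tsupport (addLineDeriv v f) ⊆ tsupport f := by
  refine closure_minimal (fun z hz => ?_) (isClosed_tsupport f)
  by_contra h
  apply hz
  have h1 : f z = 0 := image_eq_zero_of_notMem_tsupport h
  have h2 : fderiv ℝ f z = 0 := by
    by_contra h3
    exact h (support_fderiv_subset ℝ h3)
  simp [addLineDeriv, h1, h2]

lemma norm_iteratedFDeriv_addLineDeriv_le (v : E) {f : E → ℂ} (hf : ContDiff ℝ ∞ f) (z : E)
    {j : ℕ} {M : ℝ} (h0 : ‖iteratedFDeriv ℝ j f z‖ ≤ M)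
    (h1 : ‖iteratedFDeriv ℝ (j + 1) f z‖ ≤ M) :
    ‖iteratedFDeriv ℝ j (addLineDeriv v f) z‖ ≤ (1 + ‖v‖) * M := by
  have hd : ContDiff ℝ ∞ (fderiv ℝ f) := hf.fderiv_right (by simp)
  have hd' : ContDiff ℝ ∞ (fun z => fderiv ℝ f z v) := hd.clm_apply contDiff_const
  have hj : ((j : ℕ) : WithTop ℕ∞) ≤ ∞ := by exact_mod_cast le_top
  have e : addLineDeriv v f = f + fun z => fderiv ℝ f z v := rfl
  rw [e, iteratedFDeriv_add_apply (hf.contDiffAt.of_le hj) (hd'.contDiffAt.of_le hj)]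
  have h2 : ‖iteratedFDeriv ℝ j (fun z => fderiv ℝ f z v) z‖ ≤ ‖v‖ * M := by
    refine (norm_iteratedFDeriv_clm_apply_const hd.contDiffAt hj).trans ?_
    rw [norm_iteratedFDeriv_fderiv]
    gcongr
  calc _ ≤ _ := norm_add_le _ _
    _ ≤ M + ‖v‖ * M := add_le_add h0 h2
    _ = _ := by ring

lemma contDiff_iterate_addLineDeriv (v : E) {f : E → ℂ} (hf : ContDiff ℝ ∞ f) (n : ℕ) :
    ContDiff ℝ ∞ ((addLineDeriv v)^[n] f) := by
  induction n generalizing f with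
  | zero => exact hf
  | succ n ih => exact ih (contDiff_addLineDeriv v hf)

lemma norm_iterate_addLineDeriv_le (v : E) (n : ℕ) {f : E → ℂ} (hf : ContDiff ℝ ∞ f) (z : E)
    {M : ℝ} (h : ∀ j ≤ n, ‖iteratedFDeriv ℝ j f z‖ ≤ M) :
    ‖(addLineDeriv v)^[n] f z‖ ≤ (1 + ‖v‖) ^ n * M := by
  induction n generalizing f M with
  | zero => simpa using h 0 le_rfl
  | succ n ih =>
    have := ih (contDiff_addLineDeriv v hf) (M := (1 + ‖v‖) * M) fun j hj =>
      norm_iteratedFDeriv_addLineDeriv_le v hf z (h j (by omega)) (h (j + 1) (by omega))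
    rw [Function.iterate_succ_apply, pow_succ, mul_assoc]
    exact this

/-- The transpose of `(1 + iθ)⁻¹ (1 - ∂_v)`, acting on amplitudes. -/
def transport (v : E) (g : E × ℝ → ℂ) (p : E × ℝ) : ℂ :=
  (1 + Complex.I * (p.2 : ℂ))⁻¹ * addLineDeriv ((v, 0) : E × ℝ) g p

lemma one_add_I_mul_ne_zero (x : ℝ) : (1 + Complex.I * (x : ℂ)) ≠ 0 := by
  intro h
  have := congrArg Complex.re h
  simp at this

lemma norm_one_add_I_mul_sq (x : ℝ) : ‖(1 + Complex.I * (x : ℂ))‖ ^ 2 = 1 + x ^ 2 := by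
  rw [← Complex.normSq_eq_norm_sq, Complex.normSq_apply]
  simp
  ring

lemma contDiff_inv_one_add : ContDiff ℝ ∞ (fun p : E × ℝ => (1 + Complex.I * (p.2 : ℂ))⁻¹) := by
  refine ContDiff.inv ?_ fun p => one_add_I_mul_ne_zero _
  exact contDiff_const.add
    (contDiff_const.mul (Complex.ofRealCLM.contDiff.comp contDiff_snd))

lemma contDiff_transport (v : E) {g : E × ℝ → ℂ} (hg : ContDiff ℝ ∞ g) :
    ContDiff ℝ ∞ (transport v g) :=
  contDiff_inv_one_add.mul (contDiff_addLineDeriv _ hg)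

lemma tsupport_transport_subset (v : E) (g : E × ℝ → ℂ) :
    tsupport (transport v g) ⊆ tsupport g :=
  (tsupport_mul_subset_right (g := addLineDeriv ((v, 0) : E × ℝ) g)).trans
    (tsupport_addLineDeriv_subset _ g)

lemma contDiff_iterate_transport (v : E) {g : E × ℝ → ℂ} (hg : ContDiff ℝ ∞ g) (n : ℕ) :
    ContDiff ℝ ∞ ((transport v)^[n] g) := by
  induction n generalizing g with
  | zero => exact hg
  | succ n ih => exact ih (contDiff_transport v hg)

lemma tsupport_iterate_transport_subset (v : E) (g : E × ℝ → ℂ) (n : ℕ) :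
    tsupport ((transport v)^[n] g) ⊆ tsupport g := by
  induction n generalizing g with
  | zero => exact subset_rfl
  | succ n ih => exact (ih _).trans (tsupport_transport_subset v g)

lemma fderiv_prod_inl (v : E) {g : E × ℝ → ℂ} (hg : Differentiable ℝ g) (z : E) (θ : ℝ) :
    fderiv ℝ g (z, θ) (v, 0) = fderiv ℝ (fun z' => g (z', θ)) z v := by
  have h : HasFDerivAt (fun z' : E => g (z', θ))
      ((fderiv ℝ g (z, θ)).comp (ContinuousLinearMap.inl ℝ E ℝ)) z :=
    (hg (z, θ)).hasFDerivAt.comp z (hasFDerivAt_prodMk_left z θ)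
  rw [h.fderiv]
  simp

/-- The direction `v` does not involve `θ`, so the weight `(1 + iθ)⁻¹` is a constant for the
differentiation and the iterates split into a power of the weight and a derivative at frozen `θ`. -/
lemma iterate_transport_apply (v : E) (n : ℕ) {g : E × ℝ → ℂ} (hg : ContDiff ℝ ∞ g) (z : E)
    (θ : ℝ) :
    (transport v)^[n] g (z, θ) =
      ((1 + Complex.I * (θ : ℂ))⁻¹) ^ n * (addLineDeriv v)^[n] (fun z' => g (z', θ)) z := by
  induction n generalizing z with
  | zero => simp
  | succ n ih =>
    have hg1 : ContDiff ℝ ∞ (fun z' => g (z', θ)) := hg.comp (contDiff_prodMk_left θ)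
    have hd : Differentiable ℝ ((addLineDeriv v)^[n] fun z' => g (z', θ)) :=
      (contDiff_iterate_addLineDeriv v hg1 n).differentiable (by simp)
    rw [Function.iterate_succ_apply', Function.iterate_succ_apply', transport, addLineDeriv,
      addLineDeriv, fderiv_prod_inl v ((contDiff_iterate_transport v hg n).differentiable (by simp)),
      ih, funext ih, fderiv_const_mul hd.differentiableAt]
    simp only [_root_.smul_apply, smul_eq_mul]
    ring

/-- The derivatives never fall on a factor depending on `θ` alone. This applies to the cutoff
`χ(εθ)`, so no bounds on its derivatives are needed. -/
lemma transport_mul_snd (v : E) (c : ℝ → ℂ) (hc : ContDiff ℝ ∞ c) {g : E × ℝ → ℂ}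
    (hg : ContDiff ℝ ∞ g) :
    transport v (fun p => c p.2 * g p) = fun p => c p.2 * transport v g p := by
  ext ⟨z, θ⟩
  have h1 : Differentiable ℝ (fun p : E × ℝ => c p.2 * g p) :=
    ((hc.comp contDiff_snd).mul hg).differentiable (by simp)
  have h2 : Differentiable ℝ (fun z' => g (z', θ)) :=
    (hg.comp (contDiff_prodMk_left θ)).differentiable (by simp)
  rw [transport, transport, addLineDeriv, addLineDeriv, fderiv_prod_inl v h1,
    fderiv_prod_inl v (hg.differentiable (by simp))]
  dsimp only
  rw [fderiv_const_mul h2.differentiableAt]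
  simp only [_root_.smul_apply, smul_eq_mul]
  ring

lemma iterate_transport_mul_snd (v : E) (c : ℝ → ℂ) (hc : ContDiff ℝ ∞ c) {g : E × ℝ → ℂ}
    (hg : ContDiff ℝ ∞ g) (n : ℕ) :
    (transport v)^[n] (fun p => c p.2 * g p) = fun p => c p.2 * (transport v)^[n] g p := by
  induction n generalizing g with
  | zero => rfl
  | succ n ih =>
    rw [Function.iterate_succ_apply, Function.iterate_succ_apply, transport_mul_snd v c hc hg,
      ih (contDiff_transport v hg)]

variable [MeasureSpace E] [BorelSpace E] [FiniteDimensional ℝ E]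
  [(volume : Measure E).IsAddHaarMeasure]

lemma isAddHaarMeasure_volume_prod {F : Type*} [NormedAddCommGroup F] [NormedSpace ℝ F]
    [MeasureSpace F] [BorelSpace F] [FiniteDimensional ℝ F]
    [(volume : Measure F).IsAddHaarMeasure] :
    (volume : Measure (E × F)).IsAddHaarMeasure :=
  inferInstanceAs ((volume : Measure E).prod (volume : Measure F)).IsAddHaarMeasure

lemma contDiff_exp_phase {F : Type*} [NormedAddCommGroup F] [NormedSpace ℝ F] {φ : F → ℝ}
    (hφ : ContDiff ℝ ∞ φ) : ContDiff ℝ ∞ (fun p => Complex.exp (Complex.I * (φ p : ℂ))) :=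
  Complex.contDiff_exp.comp (contDiff_const.mul (Complex.ofRealCLM.contDiff.comp hφ))

/-- With `e = e^{iφ}` one has `∂_v e = -iθ e`. For `k = (1 + iθ)⁻¹ g` this gives `e g = e k - (∂_v
e) k`, and integration by parts moves `∂_v` onto `k`. -/
lemma integral_exp_mul_eq_transport {φ : E × ℝ → ℝ} (hφ : ContDiff ℝ ∞ φ) {v : E}
    (hv : ∀ p, fderiv ℝ φ p (v, 0) = -p.2) {g : E × ℝ → ℂ} (hg : ContDiff ℝ ∞ g)
    (hc : HasCompactSupport g) :
    ∫ p, Complex.exp (Complex.I * (φ p : ℂ)) * g p =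
      ∫ p, Complex.exp (Complex.I * (φ p : ℂ)) * transport v g p := by
  have : (volume : Measure (E × ℝ)).IsAddHaarMeasure := isAddHaarMeasure_volume_prod
  set e : E × ℝ → ℂ := fun p => Complex.exp (Complex.I * (φ p : ℂ)) with he
  have hes : ContDiff ℝ ∞ e := contDiff_exp_phase hφ
  set k : E × ℝ → ℂ := fun p => (1 + Complex.I * (p.2 : ℂ))⁻¹ * g p with hk
  have hks : ContDiff ℝ ∞ k := contDiff_inv_one_add.mul hg
  have hkc : HasCompactSupport k := hc.mul_left
  have hde : ∀ p, fderiv ℝ e p (v, 0) = -(Complex.I * (p.2 : ℂ)) * e p := by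
    intro p
    have h1 : HasFDerivAt φ (fderiv ℝ φ p) p := (hφ.differentiable (by simp) p).hasFDerivAt
    have h2 : HasFDerivAt (fun p => Complex.I * (φ p : ℂ))
        (Complex.I • Complex.ofRealCLM.comp (fderiv ℝ φ p)) p :=
      (Complex.ofRealCLM.hasFDerivAt.comp p h1).const_mul Complex.I
    rw [show fderiv ℝ e p = _ from h2.cexp.fderiv]
    simp only [_root_.smul_apply, ContinuousLinearMap.comp_apply, hv,
      Complex.ofRealCLM_apply, smul_eq_mul, he]
    push_cast
    ring
  have hdk : ∀ p, addLineDeriv ((v, 0) : E × ℝ) k p = transport v g p := by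
    intro p
    have := congrFun (transport_mul_snd v (fun θ : ℝ => (1 + Complex.I * (θ : ℂ))⁻¹)
      (contDiff_inv_one_add (E := ℝ) |>.comp (contDiff_id.prodMk contDiff_id)) hg) p
    rw [transport] at this
    exact mul_left_cancel₀ (inv_ne_zero (one_add_I_mul_ne_zero p.2)) this
  have cont_int : ∀ f : E × ℝ → ℂ, Continuous f → HasCompactSupport f → Integrable f :=
    fun f h1 h2 => h1.integrable_of_hasCompactSupport h2
  have hdk' : Continuous fun p => fderiv ℝ k p (v, 0) :=
    (hks.continuous_fderiv (by simp)).clm_apply continuous_const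
  have hdkc : HasCompactSupport fun p => fderiv ℝ k p (v, 0) := hkc.fderiv_apply ℝ _
  have i1 : Integrable fun p => fderiv ℝ e p (v, 0) * k p :=
    cont_int _ (((hes.continuous_fderiv (by simp)).clm_apply continuous_const).mul hks.continuous)
      hkc.mul_left
  have i2 : Integrable fun p => e p * fderiv ℝ k p (v, 0) :=
    cont_int _ (hes.continuous.mul hdk') hdkc.mul_left
  have i3 : Integrable fun p => e p * k p :=
    cont_int _ (hes.continuous.mul hks.continuous) hkc.mul_left
  have key := integral_mul_fderiv_eq_neg_fderiv_mul_of_integrable i1 i2 i3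
    (fun p _ => hes.differentiable (by simp) p) (fun p _ => hks.differentiable (by simp) p)
  have e1 : ∀ p, e p * transport v g p = e p * k p + e p * fderiv ℝ k p (v, 0) := by
    intro p
    rw [← hdk, addLineDeriv]
    ring
  have e2 : ∀ p, e p * g p = e p * k p - fderiv ℝ e p (v, 0) * k p := by
    intro p
    have := one_add_I_mul_ne_zero p.2
    rw [hde, hk]
    field_simp
    ring
  change ∫ p, e p * g p = ∫ p, e p * transport v g p
  simp_rw [e1, e2]
  rw [integral_add i3 i2, integral_sub i3 i1, key, sub_eq_add_neg]

lemma integral_exp_mul_eq_iterate_transport {φ : E × ℝ → ℝ} (hφ : ContDiff ℝ ∞ φ) {v : E}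
    (hv : ∀ p, fderiv ℝ φ p (v, 0) = -p.2) (n : ℕ) {g : E × ℝ → ℂ} (hg : ContDiff ℝ ∞ g)
    (hc : HasCompactSupport g) :
    ∫ p, Complex.exp (Complex.I * (φ p : ℂ)) * g p =
      ∫ p, Complex.exp (Complex.I * (φ p : ℂ)) * (transport v)^[n] g p := by
  induction n generalizing g with
  | zero => rfl
  | succ n ih =>
    rw [integral_exp_mul_eq_transport hφ hv hg hc, Function.iterate_succ_apply]
    exact ih (contDiff_transport v hg)
      (hc.of_isClosed_subset (isClosed_tsupport _) (tsupport_transport_subset v g))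

end Transport

/-! ## Convergence of oscillatory integrals -/

section Convergence

variable {E : Type*} [NormedAddCommGroup E] [NormedSpace ℝ E] [MeasureSpace E] [BorelSpace E]
  [FiniteDimensional ℝ E] [(volume : Measure E).IsAddHaarMeasure]

/-- The integrable majorant of the transported amplitudes supported over `L`. -/
def majorant (L : Set E) (p : E × ℝ) : ℝ := L.indicator (fun _ => 1) p.1 * (1 + p.2 ^ 2)⁻¹

lemma majorant_nonneg (L : Set E) (p : E × ℝ) : 0 ≤ majorant L p :=
  mul_nonneg (indicator_nonneg (fun _ _ => zero_le_one) _) (by positivity)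

lemma integrable_majorant {L : Set E} (hL : IsCompact L) : Integrable (majorant L) := by
  have h1 : Integrable (L.indicator (fun _ => (1 : ℝ))) (volume : Measure E) := by
    rw [integrable_indicator_iff hL.measurableSet]
    exact integrableOn_const hL.measure_lt_top.ne
  exact h1.mul_prod integrable_inv_one_add_sq

/-- Four steps gain `|1 + iθ|⁻⁴ = (1 + θ²)⁻²`, while the amplitude grows like `(1 + |θ|)² ≤ 2(1 +
θ²)`; the integrable factor `(1 + θ²)⁻¹` remains. -/
lemma norm_iterate_transport_le (v : E) {b : E × ℝ → ℂ} (hb : ContDiff ℝ ∞ b) {L : Set E}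
    (hbL : ∀ p, p.1 ∉ L → p ∉ tsupport b) {M : ℝ}
    (hM : ∀ z ∈ L, ∀ θ : ℝ, ∀ j ≤ 4,
      ‖iteratedFDeriv ℝ j (fun z' => b (z', θ)) z‖ ≤ M * (1 + ‖θ‖) ^ 2) (p : E × ℝ) :
    ‖(transport v)^[4] b p‖ ≤ 2 * (1 + ‖v‖) ^ 4 * M * majorant L p := by
  obtain ⟨z, θ⟩ := p
  by_cases hz : z ∈ L
  · rw [iterate_transport_apply v 4 hb, norm_mul, norm_pow, norm_inv, majorant,
      indicator_of_mem hz]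
    have h1 := norm_iterate_addLineDeriv_le v 4 (f := fun z' => b (z', θ))
      (hb.comp (contDiff_prodMk_left θ)) z (hM z hz θ)
    have h2 : (‖1 + Complex.I * (θ : ℂ)‖⁻¹) ^ 4 = ((1 + θ ^ 2)⁻¹) ^ 2 := by
      rw [← norm_one_add_I_mul_sq]; ring
    have h3 : (1 + ‖θ‖) ^ 2 ≤ 2 * (1 + θ ^ 2) := by
      rw [Real.norm_eq_abs, ← sq_abs θ]; nlinarith [sq_nonneg (1 - |θ|)]
    have hM0 : 0 ≤ M := by
      have := (norm_nonneg _).trans (hM z hz θ 0 (by norm_num))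
      exact nonneg_of_mul_nonneg_left this (by positivity)
    rw [h2]
    calc _ ≤ ((1 + θ ^ 2)⁻¹) ^ 2 * ((1 + ‖v‖) ^ 4 * (M * (2 * (1 + θ ^ 2)))) :=
          mul_le_mul_of_nonneg_left (h1.trans (by gcongr)) (by positivity)
      _ = _ := by
        have : (1 + θ ^ 2) ≠ 0 := by positivity
        field_simp
  · have : (z, θ) ∉ tsupport ((transport v)^[4] b) := fun h =>
      hbL (z, θ) hz (tsupport_iterate_transport_subset v b 4 h)
    rw [image_eq_zero_of_notMem_tsupport this, majorant, indicator_of_notMem hz]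
    simp

/-- For `ε > 0` the integrand has compact support, so integration by parts applies and `χ(εθ)`
passes through it. Afterwards a bound for `χ` times the majorant dominates uniformly in `ε`, and
`χ(εθ) → χ(0) = 1` pointwise. -/
lemma tendsto_regularized {φ : E × ℝ → ℝ} (hφ : ContDiff ℝ ∞ φ) {v : E}
    (hv : ∀ p, fderiv ℝ φ p (v, 0) = -p.2) {b : E × ℝ → ℂ} (hb : ContDiff ℝ ∞ b) {L : Set E}
    (hL : IsCompact L) (hbL : ∀ p, p.1 ∉ L → p ∉ tsupport b) {M : ℝ}
    (hM : ∀ z ∈ L, ∀ θ : ℝ, ∀ j ≤ 4,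
      ‖iteratedFDeriv ℝ j (fun z' => b (z', θ)) z‖ ≤ M * (1 + ‖θ‖) ^ 2)
    {χ : ℝ → ℝ} (hχ : ContDiff ℝ ∞ χ) (hχc : HasCompactSupport χ) (hχ0 : χ 0 = 1) :
    Tendsto (fun ε : ℝ => ∫ p : E × ℝ,
        Complex.exp (Complex.I * (φ p : ℂ)) * ((χ (ε • p.2) : ℂ) * b p)) (𝓝[>] 0)
      (𝓝 (∫ p, Complex.exp (Complex.I * (φ p : ℂ)) * (transport v)^[4] b p)) := by
  have hbs := contDiff_iterate_transport v hb 4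
  have hcs : ∀ ε : ℝ, ContDiff ℝ ∞ (fun θ : ℝ => ((χ (ε • θ) : ℝ) : ℂ)) := fun ε =>
    Complex.ofRealCLM.contDiff.comp (hχ.comp (contDiff_const_smul ε))
  have hev : ∀ᶠ ε : ℝ in 𝓝[>] 0, ∫ p : E × ℝ,
      Complex.exp (Complex.I * (φ p : ℂ)) * ((χ (ε • p.2) : ℂ) * (transport v)^[4] b p) =
        ∫ p : E × ℝ, Complex.exp (Complex.I * (φ p : ℂ)) * ((χ (ε • p.2) : ℂ) * b p) := by
    filter_upwards [self_mem_nhdsWithin] with ε hε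
    have hε' : ε ≠ 0 := ne_of_gt hε
    have hgs : ContDiff ℝ ∞ (fun p : E × ℝ => (χ (ε • p.2) : ℂ) * b p) :=
      ((hcs ε).comp contDiff_snd).mul hb
    have hK : HasCompactSupport (fun θ : ℝ => χ (ε • θ)) :=
      hχc.comp_homeomorph (Homeomorph.smulOfNeZero ε hε')
    have hgc : HasCompactSupport (fun p : E × ℝ => (χ (ε • p.2) : ℂ) * b p) := by
      refine HasCompactSupport.intro (hL.prod hK) fun p hp => ?_
      by_cases h1 : p.1 ∈ L
      · have h2 : p.2 ∉ tsupport (fun θ : ℝ => χ (ε • θ)) := fun h => hp ⟨h1, h⟩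
        have h3 : χ (ε • p.2) = 0 :=
          image_eq_zero_of_notMem_tsupport (f := fun θ : ℝ => χ (ε • θ)) h2
        rw [h3, Complex.ofReal_zero, zero_mul]
      · rw [image_eq_zero_of_notMem_tsupport (hbL p h1), mul_zero]
    rw [integral_exp_mul_eq_iterate_transport hφ hv 4 hgs hgc,
      iterate_transport_mul_snd v _ (hcs ε) hb]
  refine Tendsto.congr' hev ?_
  obtain ⟨C, hC⟩ := hχ.continuous.bounded_above_of_compact_support hχc
  have hC0 : 0 ≤ C := (norm_nonneg _).trans (hC 0)
  refine tendsto_integral_filter_of_dominated_convergence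
    (fun p => C * (2 * (1 + ‖v‖) ^ 4 * M * majorant L p)) ?_ ?_
    (((integrable_majorant hL).const_mul _).const_mul _) ?_
  · have : ProperSpace E := FiniteDimensional.proper_real E
    exact Eventually.of_forall fun ε => (((contDiff_exp_phase hφ).continuous.mul
      (((hcs ε).continuous.comp continuous_snd).mul hbs.continuous))).aestronglyMeasurable
  · refine Eventually.of_forall fun ε => Eventually.of_forall fun p => ?_
    rw [norm_mul, mul_comm Complex.I, Complex.norm_exp_ofReal_mul_I, one_mul, norm_mul,
      Complex.norm_real]
    exact mul_le_mul (hC _) (norm_iterate_transport_le v hb hbL hM p) (norm_nonneg _) hC0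
  · refine Eventually.of_forall fun p => ?_
    have h1 : Tendsto (fun ε : ℝ => ((χ (ε • p.2) : ℝ) : ℂ)) (𝓝[>] 0) (𝓝 1) := by
      have : Continuous fun ε : ℝ => ((χ (ε • p.2) : ℝ) : ℂ) :=
        Complex.continuous_ofReal.comp (hχ.continuous.comp (continuous_id.smul continuous_const))
      have h2 := (this.tendsto 0).mono_left (nhdsWithin_le_nhds (s := Ioi 0))
      simpa [hχ0] using h2
    simpa using (h1.mul_const ((transport v)^[4] b p)).const_mul
      (Complex.exp (Complex.I * (φ p : ℂ)))

lemma norm_integral_iterate_transport_le {φ : E × ℝ → ℝ} {v : E} {b : E × ℝ → ℂ}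
    (hb : ContDiff ℝ ∞ b) {L : Set E}
    (hL : IsCompact L) (hbL : ∀ p, p.1 ∉ L → p ∉ tsupport b) {M : ℝ}
    (hM : ∀ z ∈ L, ∀ θ : ℝ, ∀ j ≤ 4,
      ‖iteratedFDeriv ℝ j (fun z' => b (z', θ)) z‖ ≤ M * (1 + ‖θ‖) ^ 2) :
    ‖∫ p, Complex.exp (Complex.I * (φ p : ℂ)) * (transport v)^[4] b p‖ ≤
      2 * (1 + ‖v‖) ^ 4 * M * ∫ p, majorant L p := by
  rw [← integral_const_mul]
  refine norm_integral_le_of_norm_le ((integrable_majorant hL).const_mul _)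
    (Eventually.of_forall fun p => ?_)
  rw [norm_mul, mul_comm Complex.I, Complex.norm_exp_ofReal_mul_I, one_mul]
  exact norm_iterate_transport_le v hb hbL hM p

end Convergence

/-! ## Symbols multiplied by test functions -/

section Symbols

variable {E W : Type*} [NormedAddCommGroup E] [NormedSpace ℝ E]
  [NormedAddCommGroup W] [NormedSpace ℝ W]

lemma IsSymbol.mono {μ : ℝ} {Ω Ω' : Opens E} (h : Ω' ≤ Ω) {a : E × W → ℂ}
    (ha : IsSymbol μ Ω a) : IsSymbol μ Ω' a :=
  ⟨ha.1.mono (prod_mono h subset_rfl), fun L hL hLΩ => ha.2 L hL (hLΩ.trans h)⟩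

lemma IsSymbol.zero (μ : ℝ) (Ω : Opens E) : IsSymbol μ Ω (fun _ : E × W => (0 : ℂ)) := by
  refine ⟨contDiffOn_const, fun L _ _ j k => ⟨0, fun z _ θ => ?_⟩⟩
  have h1 : iteratedFDeriv ℝ k (fun _ : W => (0 : ℂ)) θ = 0 := by
    simp [iteratedFDeriv_fun_zero]
  have h2 : iteratedFDeriv ℝ j (fun _ : E => (0 : ContinuousMultilinearMap ℝ
      (fun _ : Fin k => W) ℂ)) z = 0 := by
    simp [iteratedFDeriv_fun_zero]
  simp only [h1, h2, norm_zero, zero_mul, le_refl]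

lemma IsSymbol.comp_linearIsometryEquiv {W' : Type*} [NormedAddCommGroup W'] [NormedSpace ℝ W']
    {μ : ℝ} {Ω : Opens E} {a : E × W → ℂ} (ha : IsSymbol μ Ω a) (l : W' ≃ₗᵢ[ℝ] W) :
    IsSymbol μ Ω (fun p : E × W' => a (p.1, l p.2)) := by
  refine ⟨ha.1.comp (contDiff_fst.prodMk (l.contDiff.comp contDiff_snd)).contDiffOn
    fun p hp => ⟨hp.1, mem_univ _⟩, fun L hL hLΩ j k => ?_⟩
  obtain ⟨C, hC⟩ := ha.2 L hL hLΩ j k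
  refine ⟨C, fun z hz θ => ?_⟩
  -- Precomposition with an isometry is an isometry of multilinear maps. It carries the
  -- `θ`-derivatives of one amplitude to those of the other and preserves the norms of their
  -- `z`-derivatives.
  let Φ : ContinuousMultilinearMap ℝ (fun _ : Fin k => W) ℂ ≃ₗᵢ[ℝ]
      ContinuousMultilinearMap ℝ (fun _ : Fin k => W') ℂ :=
    { (ContinuousLinearEquiv.continuousMultilinearMapCongrLeft (𝕜 := ℝ) ℂ
        (fun _ : Fin k => l.toContinuousLinearEquiv)).toLinearEquiv with
      norm_map' := fun g =>
        ContinuousMultilinearMap.norm_compContinuous_linearIsometryEquiv g fun _ => l }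
  have h1 : (fun z' => iteratedFDeriv ℝ k (fun θ' => a (z', l θ')) θ) =
      Φ ∘ fun z' => iteratedFDeriv ℝ k (fun w => a (z', w)) (l θ) := by
    ext1 z'
    have := l.toContinuousLinearEquiv.iteratedFDerivWithin_comp_right (fun w => a (z', w))
      uniqueDiffOn_univ (x := θ) (mem_univ _) k
    rw [preimage_univ, iteratedFDerivWithin_univ, iteratedFDerivWithin_univ] at this
    exact this
  dsimp only
  rw [h1, Φ.norm_iteratedFDeriv_comp_left]
  simpa using hC z hz (l θ)

lemma IsSymbol.exists_norm_iteratedFDeriv_le {a : E × W → ℂ} {Ω : Opens E}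
    (ha : IsSymbol 2 Ω a) {L : Set E} (hL : IsCompact L) (hLΩ : L ⊆ Ω) (n : ℕ) :
    ∃ C : ℝ, 0 ≤ C ∧ ∀ z ∈ L, ∀ θ : W, ∀ j ≤ n,
      ‖iteratedFDeriv ℝ j (fun z' => a (z', θ)) z‖ ≤ C * (1 + ‖θ‖) ^ 2 := by
  choose C hC using fun j => ha.2 L hL hLΩ j 0
  refine ⟨∑ j ∈ Finset.range (n + 1), |C j|, Finset.sum_nonneg fun _ _ => abs_nonneg _,
    fun z hz θ j hj => ?_⟩
  have h1 := hC j z hz θ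
  have h2 : (fun z' => iteratedFDeriv ℝ 0 (fun θ' => a (z', θ')) θ) =
      (continuousMultilinearCurryFin0 ℝ W ℂ).symm ∘ fun z' => a (z', θ) := by
    ext1 z'
    rw [iteratedFDeriv_zero_eq_comp]; rfl
  rw [h2, LinearIsometryEquiv.norm_iteratedFDeriv_comp_left] at h1
  refine h1.trans ?_
  have h3 : (1 + ‖θ‖) ^ ((2 : ℝ) - ((0 : ℕ) : ℝ)) = (1 + ‖θ‖) ^ 2 := by
    norm_num
  rw [h3]
  gcongr
  exact (le_abs_self _).trans (Finset.single_le_sum (f := fun j => |C j|)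
    (fun _ _ => abs_nonneg _) (Finset.mem_range.2 (by omega)))

/-- The amplitude is smooth over `Ω` only; off the support of `u` the product vanishes identically,
so it is smooth on the whole space. -/
lemma contDiff_symbol_mul {a : E × W → ℂ} {Ω : Opens E}
    (ha : ContDiffOn ℝ ∞ a ((Ω : Set E) ×ˢ univ)) {u : E → ℝ} (hu : ContDiff ℝ ∞ u)
    (hs : tsupport u ⊆ Ω) : ContDiff ℝ ∞ (fun p : E × W => a p * (u p.1 : ℂ)) := by
  rw [contDiff_iff_contDiffAt]
  intro p
  have hu' : ContDiff ℝ ∞ (fun p : E × W => (u p.1 : ℂ)) :=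
    Complex.ofRealCLM.contDiff.comp (hu.comp contDiff_fst)
  by_cases hp : p.1 ∈ Ω
  · exact (ha.contDiffAt ((Ω.isOpen.prod isOpen_univ).mem_nhds ⟨hp, mem_univ _⟩)).mul
      hu'.contDiffAt
  · have h1 : p.1 ∉ tsupport u := fun h => hp (hs h)
    have h2 : ∀ᶠ q : E × W in 𝓝 p, a q * (u q.1 : ℂ) = 0 := by
      have := continuous_fst.continuousAt.preimage_mem_nhds (x := p)
        ((isClosed_tsupport u).isOpen_compl.mem_nhds h1)
      filter_upwards [this] with q hq
      rw [image_eq_zero_of_notMem_tsupport hq]; simp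
    exact contDiffAt_const.congr_of_eventuallyEq h2

lemma notMem_tsupport_symbol_mul {a : E × W → ℂ} {u : E → ℝ} {L : Set E} (hL : tsupport u ⊆ L)
    (p : E × W) (hp : p.1 ∉ L) : p ∉ tsupport (fun p : E × W => a p * (u p.1 : ℂ)) := by
  have : tsupport (fun p : E × W => a p * (u p.1 : ℂ)) ⊆ Prod.fst ⁻¹' tsupport u := by
    refine closure_minimal (fun q hq => subset_tsupport _ ?_)
      ((isClosed_tsupport u).preimage continuous_fst)
    intro h
    apply hq
    simp [h]
  exact fun h => hp (hL (this h))

/-- Leibniz rule; `2 ^ n` bounds the sum of the binomial coefficients. The derivatives are taken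
within `Ω`, where alone `f` is known to be smooth. -/
lemma norm_iteratedFDeriv_symbol_mul_le {f : E → ℂ} {Ω : Opens E} (hf : ContDiffOn ℝ ∞ f Ω)
    {u : E → ℝ} (hu : ContDiff ℝ ∞ u) {z : E} (hz : z ∈ Ω) {n : ℕ} {A B : ℝ} (hB : 0 ≤ B)
    (hfA : ∀ j ≤ n, ‖iteratedFDeriv ℝ j f z‖ ≤ A) (huB : ∀ j ≤ n, ‖iteratedFDeriv ℝ j u z‖ ≤ B)
    {j : ℕ} (hj : j ≤ n) :
    ‖iteratedFDeriv ℝ j (fun z => f z * (u z : ℂ)) z‖ ≤ 2 ^ n * (A * B) := by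
  have hA : 0 ≤ A := (norm_nonneg _).trans (hfA 0 (Nat.zero_le _))
  have hu' : ContDiff ℝ ∞ (fun z => (u z : ℂ)) := Complex.ofRealCLM.contDiff.comp hu
  have hj' : ((j : ℕ) : WithTop ℕ∞) ≤ ∞ := by exact_mod_cast le_top
  have h := norm_iteratedFDerivWithin_mul_le hf hu'.contDiffOn Ω.isOpen.uniqueDiffOn hz hj'
  rw [iteratedFDerivWithin_of_isOpen j Ω.isOpen hz] at h
  refine h.trans ?_
  have h2 : ∀ i ∈ Finset.range (j + 1), ((j.choose i : ℕ) : ℝ) *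
      ‖iteratedFDerivWithin ℝ i f Ω z‖ * ‖iteratedFDerivWithin ℝ (j - i) (fun z => (u z : ℂ)) Ω z‖ ≤
      ((j.choose i : ℕ) : ℝ) * (A * B) := by
    intro i hi
    have hi' : i ≤ j := Nat.lt_succ_iff.1 (Finset.mem_range.1 hi)
    rw [iteratedFDerivWithin_of_isOpen i Ω.isOpen hz,
      iteratedFDerivWithin_of_isOpen (j - i) Ω.isOpen hz, mul_assoc]
    have h3 : ‖iteratedFDeriv ℝ (j - i) (fun z => (u z : ℂ)) z‖ ≤ B := by
      have := Complex.ofRealLI.norm_iteratedFDeriv_comp_left (hu.contDiffAt (x := z))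
        (i := j - i) (WithTop.coe_le_coe.2 le_top)
      rw [show (fun z => (u z : ℂ)) = Complex.ofRealLI ∘ u from rfl, this]
      exact huB _ (by omega)
    gcongr
    exact hfA i (by omega)
  refine (Finset.sum_le_sum h2).trans ?_
  rw [← Finset.sum_mul]
  have h4 : (∑ i ∈ Finset.range (j + 1), ((j.choose i : ℕ) : ℝ)) = 2 ^ j := by
    exact_mod_cast Nat.sum_range_choose j
  rw [h4]
  gcongr
  norm_num

end Symbols

/-! ## Distributions defined by oscillatory integrals -/

section OscillatoryDistribution

variable {E : Type*} [NormedAddCommGroup E] [NormedSpace ℝ E]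

/-- A functional on test functions of order at most `n`, locally uniformly. -/
def HasLocalOrderBound (n : ℕ) (Ω : Opens E) (I : 𝓓(Ω, ℝ) → ℂ) : Prop :=
  ∀ L : Set E, IsCompact L → L ⊆ Ω → ∃ C : ℝ, 0 ≤ C ∧ ∀ u : 𝓓(Ω, ℝ), tsupport u ⊆ L →
    ∀ B : ℝ, 0 ≤ B → (∀ j ≤ n, ∀ z, ‖iteratedFDeriv ℝ j u z‖ ≤ B) → ‖I u‖ ≤ C * B

/-- Continuity of a linear functional on test functions is tested on each space of functions
supported in a fixed compact set. There the order bound is a bound by a finite supremum of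
seminorms. -/
lemma HasLocalOrderBound.exists_distribution {n : ℕ} {Ω : Opens E} {I : 𝓓(Ω, ℝ) → ℂ}
    (hI : HasLocalOrderBound n Ω I) (hadd : ∀ u v, I (u + v) = I u + I v)
    (hsmul : ∀ (c : ℝ) u, I (c • u) = c • I u) : ∃ K : 𝓓'(Ω, ℂ), ∀ u, K u = I u := by
  refine ⟨TestFunction.mkCLM ℝ I hadd hsmul fun K hK => ?_, fun u => rfl⟩
  obtain ⟨C, hC0, hC⟩ := hI K K.isCompact hK
  let J : 𝓓_{K}(E, ℝ) →L[ℝ] ℂ := ContDiffMapSupportedIn.mkCLMtoNormedSpace ℝ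
    (I ∘ TestFunction.ofSupportedIn hK)
    (fun f g => (congrArg I ((TestFunction.ofSupportedInCLM ℝ hK).map_add f g)).trans (hadd _ _))
    (fun c f => (congrArg I ((TestFunction.ofSupportedInCLM ℝ hK).map_smul c f)).trans
      (hsmul _ _))
    ⟨Finset.range (n + 1), C, hC0, fun f => by
      refine hC _ f.tsupport_subset _ (apply_nonneg _ _) fun j hj z => ?_
      refine (ContDiffMapSupportedIn.norm_iteratedFDeriv_apply_le_seminorm_top ℝ
        (f := f) (i := j) (x := z)).trans ?_
      exact Seminorm.le_finset_sup_apply (p := fun i => ContDiffMapSupportedIn.seminorm ℝ E ℝ ⊤ K i)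
        (Finset.mem_range.2 (by omega))⟩
  exact J.continuous

/-- Gives the additivity in the test function of the functional defined by the transported integral.
-/
lemma iterate_transport_add (v : E) {f g : E × ℝ → ℂ} (hf : ContDiff ℝ ∞ f)
    (hg : ContDiff ℝ ∞ g) (n : ℕ) :
    (transport v)^[n] (f + g) = (transport v)^[n] f + (transport v)^[n] g := by
  induction n generalizing f g with
  | zero => rfl
  | succ n ih =>
    have h : transport v (f + g) = transport v f + transport v g := by
      ext p
      simp only [transport, addLineDeriv, Pi.add_apply]
      rw [fderiv_add (hf.differentiable (by simp) p) (hg.differentiable (by simp) p)]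
      simp only [_root_.add_apply]
      ring
    rw [Function.iterate_succ_apply, h, ih (contDiff_transport v hf) (contDiff_transport v hg)]
    rfl

lemma exists_norm_iteratedFDeriv_le_of_hasCompactSupport {u : E → ℝ} (hu : ContDiff ℝ ∞ u)
    (hc : HasCompactSupport u) (n : ℕ) :
    ∃ B : ℝ, 0 ≤ B ∧ ∀ j ≤ n, ∀ z, ‖iteratedFDeriv ℝ j u z‖ ≤ B := by
  have h : ∀ j : ℕ, ∃ B, ∀ z, ‖iteratedFDeriv ℝ j u z‖ ≤ B := fun j =>
    (hu.continuous_iteratedFDeriv (WithTop.coe_le_coe.2 le_top)).bounded_above_of_compact_support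
      (hc.iteratedFDeriv j)
  choose B hB using h
  refine ⟨∑ j ∈ Finset.range (n + 1), |B j|, Finset.sum_nonneg fun _ _ => abs_nonneg _,
    fun j hj z => ((hB j z).trans (le_abs_self _)).trans ?_⟩
  exact Finset.single_le_sum (f := fun j => |B j|) (fun _ _ => abs_nonneg _)
    (Finset.mem_range.2 (by omega))

variable [MeasureSpace E] [BorelSpace E] [FiniteDimensional ℝ E]
  [(volume : Measure E).IsAddHaarMeasure]

lemma integrable_exp_mul_iterate_transport {φ : E × ℝ → ℝ} (hφ : ContDiff ℝ ∞ φ) {v : E}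
    {b : E × ℝ → ℂ} (hb : ContDiff ℝ ∞ b) {L : Set E} (hL : IsCompact L)
    (hbL : ∀ p, p.1 ∉ L → p ∉ tsupport b) {M : ℝ}
    (hM : ∀ z ∈ L, ∀ θ : ℝ, ∀ j ≤ 4,
      ‖iteratedFDeriv ℝ j (fun z' => b (z', θ)) z‖ ≤ M * (1 + ‖θ‖) ^ 2) :
    Integrable fun p => Complex.exp (Complex.I * (φ p : ℂ)) * (transport v)^[4] b p := by
  have : ProperSpace E := FiniteDimensional.proper_real E
  refine ((integrable_majorant hL).const_mul (2 * (1 + ‖v‖) ^ 4 * M)).mono'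
    ((contDiff_exp_phase hφ).continuous.mul
      (contDiff_iterate_transport v hb 4).continuous).aestronglyMeasurable
    (Eventually.of_forall fun p => ?_)
  rw [norm_mul, mul_comm Complex.I, Complex.norm_exp_ofReal_mul_I, one_mul]
  exact norm_iterate_transport_le v hb hbL hM p

lemma IsSymbol.exists_amplitude_bound {Ω : Opens E} {a : E × ℝ → ℂ} (ha : IsSymbol 2 Ω a)
    {L : Set E} (hL : IsCompact L) (hLΩ : L ⊆ Ω) :
    ∃ C : ℝ, 0 ≤ C ∧ ∀ u : E → ℝ, ContDiff ℝ ∞ u → ∀ B : ℝ, 0 ≤ B →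
      (∀ j ≤ 4, ∀ z, ‖iteratedFDeriv ℝ j u z‖ ≤ B) → ∀ z ∈ L, ∀ θ : ℝ, ∀ j ≤ 4,
        ‖iteratedFDeriv ℝ j (fun z' => a (z', θ) * (u z' : ℂ)) z‖ ≤ C * B * (1 + ‖θ‖) ^ 2 := by
  obtain ⟨C, hC0, hC⟩ := ha.exists_norm_iteratedFDeriv_le hL hLΩ 4
  refine ⟨2 ^ 4 * C, by positivity, fun u hu B hB huB z hz θ j hj => ?_⟩
  have hs : ContDiffOn ℝ ∞ (fun z' => a (z', θ)) Ω :=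
    ha.1.comp (contDiff_prodMk_left θ).contDiffOn fun z hz => ⟨hz, mem_univ _⟩
  refine (norm_iteratedFDeriv_symbol_mul_le hs hu (hLΩ hz) hB (hC z hz θ)
    (fun j hj => huB j hj z) hj).trans (le_of_eq ?_)
  ring

/-- The value is defined by the absolutely convergent integral obtained after four integrations by
parts. The order bound is retained because it yields the operator with this kernel. -/
theorem exists_oscillatory_distribution {Ω : Opens E} {a : E × ℝ → ℂ} (ha : IsSymbol 2 Ω a)
    {φ : E × ℝ → ℝ} (hφ : ContDiff ℝ ∞ φ) {v : E} (hv : ∀ p, fderiv ℝ φ p (v, 0) = -p.2) :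
    ∃ K : 𝓓'(Ω, ℂ), HasLocalOrderBound 4 Ω K ∧
      ∀ u : 𝓓(Ω, ℝ), HasOscillatoryIntegral φ a u (K u) := by
  let b : 𝓓(Ω, ℝ) → E × ℝ → ℂ := fun u p => a p * (u p.1 : ℂ)
  let I : 𝓓(Ω, ℝ) → ℂ := fun u =>
    ∫ p, Complex.exp (Complex.I * (φ p : ℂ)) * (transport v)^[4] (b u) p
  have hb : ∀ u, ContDiff ℝ ∞ (b u) := fun u =>
    contDiff_symbol_mul ha.1 u.contDiff u.tsupport_subset
  have hbL : ∀ (u : 𝓓(Ω, ℝ)) (L : Set E), tsupport u ⊆ L → ∀ p : E × ℝ, p.1 ∉ L →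
      p ∉ tsupport (b u) := fun u L hL p hp => notMem_tsupport_symbol_mul hL p hp
  have hM : ∀ u : 𝓓(Ω, ℝ), ∃ M, ∀ z ∈ tsupport u, ∀ θ : ℝ, ∀ j ≤ 4,
      ‖iteratedFDeriv ℝ j (fun z' => b u (z', θ)) z‖ ≤ M * (1 + ‖θ‖) ^ 2 := by
    intro u
    obtain ⟨C, -, hC⟩ := ha.exists_amplitude_bound u.hasCompactSupport u.tsupport_subset
    obtain ⟨B, hB0, hB⟩ :=
      exists_norm_iteratedFDeriv_le_of_hasCompactSupport u.contDiff u.hasCompactSupport 4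
    exact ⟨C * B, hC u u.contDiff B hB0 hB⟩
  have hint : ∀ u, Integrable fun p =>
      Complex.exp (Complex.I * (φ p : ℂ)) * (transport v)^[4] (b u) p := fun u =>
    integrable_exp_mul_iterate_transport hφ (hb u) u.hasCompactSupport (hbL u _ subset_rfl)
      (hM u).choose_spec
  have hosc : ∀ u : 𝓓(Ω, ℝ), HasOscillatoryIntegral φ a u (I u) := by
    intro u χ hχ hχc hχ0
    have := tendsto_regularized hφ hv (hb u) u.hasCompactSupport (hbL u _ subset_rfl)
      (hM u).choose_spec hχ hχc hχ0
    simpa only [b, mul_assoc] using this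
  have hord : HasLocalOrderBound 4 Ω I := by
    intro L hL hLΩ
    obtain ⟨C, hC0, hC⟩ := ha.exists_amplitude_bound hL hLΩ
    refine ⟨2 * (1 + ‖v‖) ^ 4 * C * ∫ p, majorant L p,
      mul_nonneg (by positivity) (integral_nonneg fun p => majorant_nonneg L p),
      fun u huL B hB0 hB => ?_⟩
    refine (norm_integral_iterate_transport_le (hb u) hL (hbL u L huL)
      (hC u u.contDiff B hB0 hB)).trans (le_of_eq ?_)
    ring
  obtain ⟨K, hK⟩ := hord.exists_distribution
    (fun u w => by
      have e : b (u + w) = b u + b w := by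
        ext p
        simp only [b, Pi.add_apply, _root_.add_apply]
        push_cast
        ring
      simp only [I]
      rw [e, iterate_transport_add v (hb u) (hb w), ← integral_add (hint u) (hint w)]
      exact integral_congr_ae (Eventually.of_forall fun p => mul_add _ _ _))
    (fun c u => by
      have e : b (c • u) = fun p => (c : ℂ) * b u p := by
        ext p
        simp only [b, _root_.smul_apply, smul_eq_mul]
        push_cast
        ring
      simp only [I]
      rw [e, iterate_transport_mul_snd v (fun _ => (c : ℂ)) contDiff_const (hb u),
        Complex.real_smul, ← integral_const_mul]
      exact integral_congr_ae (Eventually.of_forall fun p => mul_left_comm _ _ _))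
  have hKI : (K : 𝓓(Ω, ℝ) → ℂ) = I := funext hK
  exact ⟨K, hKI ▸ hord, fun u => (hK u).symm ▸ hosc u⟩

end OscillatoryDistribution

/-! ### Tensor products of test functions, and operators defined by Schwartz kernels. -/

section Tensor

variable {E₁ E₂ : Type*} [NormedAddCommGroup E₁] [NormedSpace ℝ E₁]
  [NormedAddCommGroup E₂] [NormedSpace ℝ E₂] {Y : Opens E₁} {X : Opens E₂}

lemma tensor_apply (u : 𝓓(Y, ℝ)) (V : 𝓓(X, ℝ)) (p : E₁ × E₂) : tensor u V p = u p.1 * V p.2 :=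
  rfl

lemma tsupport_tensor_subset (u : 𝓓(Y, ℝ)) (V : 𝓓(X, ℝ)) :
    tsupport (tensor u V) ⊆ tsupport u ×ˢ tsupport V := by
  refine closure_minimal (fun p hp => ?_) ((isClosed_tsupport _).prod (isClosed_tsupport _))
  have hp' : u p.1 * V p.2 ≠ 0 := hp
  exact ⟨subset_tsupport _ (left_ne_zero_of_mul hp'), subset_tsupport _ (right_ne_zero_of_mul hp')⟩

lemma norm_iteratedFDeriv_comp_clm_le {E F : Type*} [NormedAddCommGroup E] [NormedSpace ℝ E]
    [NormedAddCommGroup F] [NormedSpace ℝ F] {l : E →L[ℝ] F} (hl : ‖l‖ ≤ 1) {f : F → ℝ}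
    (hf : ContDiff ℝ ∞ f) (j : ℕ) (z : E) :
    ‖iteratedFDeriv ℝ j (fun z => f (l z)) z‖ ≤ ‖iteratedFDeriv ℝ j f (l z)‖ := by
  rw [show (fun z => f (l z)) = f ∘ l from rfl,
    l.iteratedFDeriv_comp_right hf z (WithTop.coe_le_coe.2 le_top)]
  refine (ContinuousMultilinearMap.norm_compContinuousLinearMap_le _ _).trans ?_
  refine mul_le_of_le_one_right (norm_nonneg _) (Finset.prod_le_one (fun _ _ => norm_nonneg _)
    fun _ _ => hl)

lemma norm_iteratedFDeriv_tensor_le (u : 𝓓(Y, ℝ)) (V : 𝓓(X, ℝ)) {n : ℕ} {A B : ℝ} (hA : 0 ≤ A)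
    (hB : 0 ≤ B)
    (hu : ∀ j ≤ n, ∀ z, ‖iteratedFDeriv ℝ j u z‖ ≤ A)
    (hV : ∀ j ≤ n, ∀ z, ‖iteratedFDeriv ℝ j V z‖ ≤ B) (j : ℕ) (hj : j ≤ n) (p : E₁ × E₂) :
    ‖iteratedFDeriv ℝ j (tensor u V) p‖ ≤ 2 ^ n * (A * B) := by
  have h := norm_iteratedFDeriv_mul_le (𝕜 := ℝ) (N := ∞) (u.contDiff.comp contDiff_fst)
    (V.contDiff.comp contDiff_snd) p (n := j) (WithTop.coe_le_coe.2 le_top)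
  refine h.trans ?_
  have h2 : ∀ i ∈ Finset.range (j + 1), ((j.choose i : ℕ) : ℝ) *
      ‖iteratedFDeriv ℝ i (u ∘ Prod.fst) p‖ * ‖iteratedFDeriv ℝ (j - i) (V ∘ Prod.snd) p‖ ≤
      ((j.choose i : ℕ) : ℝ) * (A * B) := by
    intro i hi
    have hi' : i ≤ j := Nat.lt_succ_iff.1 (Finset.mem_range.1 hi)
    rw [mul_assoc]
    have h3 : ‖iteratedFDeriv ℝ i (u ∘ Prod.fst) p‖ ≤ A :=
      (norm_iteratedFDeriv_comp_clm_le (l := ContinuousLinearMap.fst ℝ E₁ E₂)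
        (ContinuousLinearMap.norm_fst_le _ _ _) u.contDiff i p).trans (hu i (by omega) _)
    have h4 : ‖iteratedFDeriv ℝ (j - i) (V ∘ Prod.snd) p‖ ≤ B :=
      (norm_iteratedFDeriv_comp_clm_le (l := ContinuousLinearMap.snd ℝ E₁ E₂)
        (ContinuousLinearMap.norm_snd_le _ _ _) V.contDiff (j - i) p).trans
        (hV _ (by omega) _)
    exact mul_le_mul_of_nonneg_left (mul_le_mul h3 h4 (norm_nonneg _) hA) (Nat.cast_nonneg _)
  refine (Finset.sum_le_sum h2).trans ?_
  rw [← Finset.sum_mul]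
  have h4 : (∑ i ∈ Finset.range (j + 1), ((j.choose i : ℕ) : ℝ)) = 2 ^ j := by
    exact_mod_cast Nat.sum_range_choose j
  rw [h4]
  gcongr
  norm_num

/-- The operator with a given Schwartz kernel of locally bounded order. -/
lemma HasLocalOrderBound.exists_operator {n : ℕ} {K : 𝓓'(prodOpens Y X, ℂ)}
    (hK : HasLocalOrderBound n (prodOpens Y X) K) :
    ∃ F : 𝓓(X, ℝ) →ₗ[ℝ] 𝓓'(Y, ℂ), ∀ V u, F V u = K (tensor u V) := by
  have h : ∀ V : 𝓓(X, ℝ), ∃ T : 𝓓'(Y, ℂ), ∀ u, T u = K (tensor u V) := by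
    intro V
    have hb : HasLocalOrderBound n Y fun u => K (tensor u V) := by
      intro L hL hLY
      -- The order bound of `K` on `L × supp V`, with the Leibniz rule for `u ⊗ V`, bounds the order
      -- in `u`; continuity of the tensor product map itself is not needed.
      obtain ⟨C, hC0, hC⟩ := hK (L ×ˢ tsupport V) (hL.prod V.hasCompactSupport)
        (prod_mono hLY V.tsupport_subset)
      obtain ⟨B, hB0, hB⟩ :=
        exists_norm_iteratedFDeriv_le_of_hasCompactSupport V.contDiff V.hasCompactSupport n
      refine ⟨C * (2 ^ n * B), by positivity, fun u huL A hA0 hA => ?_⟩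
      refine (hC (tensor u V) ((tsupport_tensor_subset u V).trans (prod_mono huL subset_rfl))
        (2 ^ n * (A * B)) (by positivity)
        (norm_iteratedFDeriv_tensor_le u V hA0 hB0 hA hB)).trans (le_of_eq ?_)
      ring
    refine hb.exists_distribution (fun u w => ?_) (fun c u => ?_)
    · rw [← map_add]
      congr 1
      ext p
      simp only [tensor_apply, _root_.add_apply]
      ring
    · rw [← map_smul]
      congr 1
      ext p
      simp only [tensor_apply, _root_.smul_apply, smul_eq_mul]
      ring
  choose T hT using h
  refine ⟨⟨⟨T, fun V V' => ?_⟩, fun c V => ?_⟩, hT⟩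
  · ext u
    rw [_root_.add_apply, hT, hT, hT, ← map_add]
    congr 1
    ext p
    simp only [tensor_apply, _root_.add_apply]
    ring
  · ext u
    rw [RingHom.id_apply, _root_.smul_apply, hT, hT, ← map_smul]
    congr 1
    ext p
    simp only [tensor_apply, _root_.smul_apply, smul_eq_mul]
    ring

end Tensor

/-! ### Isometric changes of the frequency variable, from `ℝ` to one-dimensional Euclidean space. -/

section ChangeOfPhaseVariable

variable {E W W' : Type*} [NormedAddCommGroup E] [NormedSpace ℝ E] [MeasureSpace E]
  [SFinite (volume : Measure E)]
  [NormedAddCommGroup W] [NormedSpace ℝ W] [MeasureSpace W] [BorelSpace W]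
  [SFinite (volume : Measure W)]
  [NormedAddCommGroup W'] [NormedSpace ℝ W'] [MeasureSpace W'] [BorelSpace W']
  [SFinite (volume : Measure W')]

/-- A cutoff `χ` in the new variable corresponds to `χ ∘ l⁻¹` in the old one, and linearity of `l`
makes this compatible with the scaling by `ε`. -/
lemma HasOscillatoryIntegral.comp_linearIsometryEquiv {φ : E × W → ℝ} {a : E × W → ℂ}
    {u : E → ℝ} {I : ℂ} (h : HasOscillatoryIntegral φ a u I) (l : W' ≃ₗᵢ[ℝ] W)
    (hl : MeasurePreserving l) :
    HasOscillatoryIntegral (fun p : E × W' => φ (p.1, l p.2)) (fun p => a (p.1, l p.2)) u I := by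
  intro χ hχ hχc hχ0
  have := h (χ ∘ l.symm) (hχ.comp l.symm.contDiff) (hχc.comp_homeomorph l.symm.toHomeomorph)
    (by simp [hχ0])
  refine this.congr fun ε => ?_
  have hm : MeasurePreserving (Prod.map id l : E × W' → E × W) :=
    (MeasurePreserving.id volume).prod hl
  have he : MeasurableEmbedding (Prod.map id l : E × W' → E × W) :=
    MeasurableEmbedding.id.prodMap l.toHomeomorph.measurableEmbedding
  rw [← hm.integral_comp he]
  simp
  rfl

/-- Evaluation at the only coordinate of `ℝ¹`. -/
def euclideanOneEquiv : EuclideanSpace ℝ (Fin 1) ≃ₗᵢ[ℝ] ℝ where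
  toFun θ := θ 0
  invFun x := EuclideanSpace.single 0 x
  map_add' _ _ := rfl
  map_smul' _ _ := rfl
  left_inv θ := by
    ext i
    fin_cases i
    simp
  right_inv x := by simp
  norm_map' θ := by
    simp [EuclideanSpace.norm_eq, Real.sqrt_sq_eq_abs]
    rfl

lemma measurePreserving_euclideanOneEquiv : MeasurePreserving euclideanOneEquiv :=
  (volume_preserving_funUnique (Fin 1) ℝ).comp (PiLp.volume_preserving_ofLp (Fin 1))

end ChangeOfPhaseVariable

/-! ## Conormal bundles of hypersurfaces and phases that are linear in one frequency -/

section LinearPhase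

variable {E : Type*} [NormedAddCommGroup E] [NormedSpace ℝ E]

/-- The conormal bundle, without its zero section, of the hypersurface `{ρ = 0}` of `Ω`. -/
def conormalBundle (Ω : Opens E) (ρ : E → ℝ) : Set (E × StrongDual ℝ E) :=
  {p | p.1 ∈ Ω ∧ ρ p.1 = 0 ∧ ∃ w : ℝ, w ≠ 0 ∧ p.2 = w • fderiv ℝ ρ p.1}

/-- The phase `θ ρ(z)` with one frequency variable. -/
def linearPhase (ρ : E → ℝ) (p : E × EuclideanSpace ℝ (Fin 1)) : ℝ := p.2 0 * ρ p.1

/-- The whole cone `Ω × (W ∖ 0)`. -/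
def fullCone (Ω : Opens E) (W : Type*) [NormedAddCommGroup W] : Set (E × W) :=
  {p | p.1 ∈ Ω ∧ p.2 ≠ 0}

variable {Ω : Opens E} {ρ : E → ℝ}

lemma conormalBundle_conic {p : E × StrongDual ℝ E} (hp : p ∈ conormalBundle Ω ρ) {r : ℝ}
    (hr : 0 < r) : (p.1, r • p.2) ∈ conormalBundle Ω ρ := by
  obtain ⟨h1, h2, w, hw, h3⟩ := hp
  exact ⟨h1, h2, r * w, mul_ne_zero hr.ne' hw, by simp [h3, mul_smul]⟩

/-- The multiplier in `η = w dρ` is recovered as `w = -η(e)`. The existential condition thus becomes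
the closed equation `η = -η(e) dρ`, and `w ≠ 0` becomes `η ≠ 0`. -/
lemma conormalBundle_eq_inter (hρ : ContDiff ℝ ∞ ρ) {e : E} (he : ∀ z, fderiv ℝ ρ z e = -1) :
    ∃ C : Set (E × StrongDual ℝ E), IsClosed C ∧
      conormalBundle Ω ρ = {p ∈ C | p.1 ∈ Ω ∧ p.2 ≠ 0} := by
  refine ⟨{p | ρ p.1 = 0 ∧ p.2 = (-p.2 e) • fderiv ℝ ρ p.1}, ?_, ?_⟩
  · have h1 : Continuous (fderiv ℝ ρ) := hρ.continuous_fderiv (by simp)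
    refine (isClosed_eq (hρ.continuous.comp continuous_fst) continuous_const).inter
      (isClosed_eq continuous_snd ?_)
    exact ((continuous_snd.clm_apply continuous_const).neg).smul (h1.comp continuous_fst)
  · ext ⟨z, η⟩
    constructor
    · rintro ⟨h1, h2, w, hw, h3⟩
      dsimp only at h1 h2 h3
      have h4 : η e = -w := by simp [h3, he]
      refine ⟨⟨h2, ?_⟩, h1, fun h5 => hw ?_⟩
      · dsimp only
        rw [h4, neg_neg, h3]
      · dsimp only at h5
        rw [h5] at h4
        simpa using h4.symm
    · rintro ⟨⟨h1, h2⟩, h3, h4⟩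
      refine ⟨h3, h1, -η e, fun h5 => h4 ?_, h2⟩
      dsimp only at h2 ⊢
      rw [h2, h5, zero_smul]

/-- The terms that differentiate `f` contain `dρ` on a vector tangent to `{ρ = 0}` and vanish. The
other two cancel by symmetry of the second derivative of `ρ`. -/
lemma symplecticForm_conormal_eq_zero {M : Type*} [NormedAddCommGroup M] [NormedSpace ℝ M]
    (hρ : ContDiff ℝ ∞ ρ) {z : M → E} {f : M → ℝ} (hz : Differentiable ℝ z)
    (hf : Differentiable ℝ f) (h0 : ∀ u, ρ (z u) = 0) (u v w : M) :
    symplecticForm (fderiv ℝ (fun u => (z u, f u • fderiv ℝ ρ (z u))) u v)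
      (fderiv ℝ (fun u => (z u, f u • fderiv ℝ ρ (z u))) u w) = 0 := by
  have hd : Differentiable ℝ (fderiv ℝ ρ) :=
    (hρ.fderiv_right (m := ∞) (by simp)).differentiable (by simp)
  have h1 : HasFDerivAt (fun u => fderiv ℝ ρ (z u))
      ((fderiv ℝ (fderiv ℝ ρ) (z u)).comp (fderiv ℝ z u)) u :=
    (hd (z u)).hasFDerivAt.comp u (hz u).hasFDerivAt
  have h2 := (hz u).hasFDerivAt.prodMk ((hf u).hasFDerivAt.smul h1)
  have h3 : ∀ v, fderiv ℝ ρ (z u) (fderiv ℝ z u v) = 0 := by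
    intro v
    have h4 : HasFDerivAt (fun u => ρ (z u)) ((fderiv ℝ ρ (z u)).comp (fderiv ℝ z u)) u :=
      (hρ.differentiable (by simp) (z u)).hasFDerivAt.comp u (hz u).hasFDerivAt
    have h5 : fderiv ℝ (fun u => ρ (z u)) u = 0 := by
      rw [funext h0]; simp
    rw [h4.fderiv] at h5
    exact congrArg (fun l => l v) h5
  have hsymm : IsSymmSndFDerivAt ℝ ρ (z u) :=
    hρ.contDiffAt.isSymmSndFDerivAt (by simp [ENat.LEInfty.out])
  rw [show fderiv ℝ (fun u => (z u, f u • fderiv ℝ ρ (z u))) u = _ from h2.fderiv]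
  simp [symplecticForm, h3, hsymm.eq (fderiv ℝ z u v) (fderiv ℝ z u w)]

lemma hasFDerivAt_linearPhase (hρ : ContDiff ℝ ∞ ρ) (p : E × EuclideanSpace ℝ (Fin 1)) :
    HasFDerivAt (linearPhase ρ)
      (p.2 0 • (fderiv ℝ ρ p.1).comp (ContinuousLinearMap.fst ℝ E (EuclideanSpace ℝ (Fin 1))) +
        ρ p.1 • (EuclideanSpace.proj 0).comp
          (ContinuousLinearMap.snd ℝ E (EuclideanSpace ℝ (Fin 1)))) p := by
  have h1 : HasFDerivAt (fun p : E × EuclideanSpace ℝ (Fin 1) => p.2 0)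
      ((EuclideanSpace.proj (𝕜 := ℝ) (0 : Fin 1)).comp
        (ContinuousLinearMap.snd ℝ E (EuclideanSpace ℝ (Fin 1)))) p :=
    ((EuclideanSpace.proj (𝕜 := ℝ) (0 : Fin 1)).comp
      (ContinuousLinearMap.snd ℝ E (EuclideanSpace ℝ (Fin 1)))).hasFDerivAt
  exact h1.mul ((hρ.differentiable (by simp) p.1).hasFDerivAt.comp p hasFDerivAt_fst)

lemma spaceDifferential_linearPhase (hρ : ContDiff ℝ ∞ ρ) (p : E × EuclideanSpace ℝ (Fin 1)) :
    spaceDifferential (linearPhase ρ) p = p.2 0 • fderiv ℝ ρ p.1 := by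
  rw [spaceDifferential, (hasFDerivAt_linearPhase hρ p).fderiv]
  ext v
  simp

lemma fderiv_linearPhase_inr (hρ : ContDiff ℝ ∞ ρ) (p : E × EuclideanSpace ℝ (Fin 1))
    (θ : EuclideanSpace ℝ (Fin 1)) : fderiv ℝ (linearPhase ρ) p (0, θ) = ρ p.1 * θ 0 := by
  rw [(hasFDerivAt_linearPhase hρ p).fderiv]
  simp

lemma criticalSet_linearPhase (hρ : ContDiff ℝ ∞ ρ) :
    criticalSet (linearPhase ρ) (fullCone Ω (EuclideanSpace ℝ (Fin 1))) =
      {p | p.1 ∈ Ω ∧ ρ p.1 = 0 ∧ p.2 ≠ 0} := by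
  ext p
  constructor
  · rintro ⟨⟨h1, h2⟩, h3⟩
    have h4 := congrArg (fun l => l (EuclideanSpace.single 0 1)) h3
    simp only [ContinuousLinearMap.comp_apply, ContinuousLinearMap.inr_apply,
      fderiv_linearPhase_inr hρ] at h4
    exact ⟨h1, by simpa using h4, h2⟩
  · rintro ⟨h1, h2, h3⟩
    refine ⟨⟨h1, h3⟩, ?_⟩
    ext θ
    simp [fderiv_linearPhase_inr hρ, h2]

lemma euclideanOne_ne_zero_iff (θ : EuclideanSpace ℝ (Fin 1)) : θ ≠ 0 ↔ θ 0 ≠ 0 := by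
  rw [not_iff_not]
  exact ⟨fun h => by simp [h], fun h => by ext i; fin_cases i; simpa using h⟩

/-- Both nonvanishing conditions are tested on `(e, 0)`: there `dφ` takes the value `-θ`, and the
differential of `∂φ/∂θ = ρ` takes the value `-1`. -/
lemma isNondegeneratePhase_linearPhase (hρ : ContDiff ℝ ∞ ρ) {e : E}
    (he : ∀ z, fderiv ℝ ρ z e = -1) :
    IsNondegeneratePhase Ω (linearPhase ρ) (fullCone Ω (EuclideanSpace ℝ (Fin 1))) := by
  refine ⟨⟨?_, fun p hp => hp, fun p hp r hr => ⟨hp.1, smul_ne_zero hr.ne' hp.2⟩⟩, ?_, ?_, ?_, ?_⟩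
  · exact (Ω.isOpen.preimage continuous_fst).inter
      (isOpen_ne_fun continuous_snd continuous_const)
  · refine ContDiff.contDiffOn (ContDiff.mul ?_ (hρ.comp contDiff_fst))
    exact ((EuclideanSpace.proj (𝕜 := ℝ) (0 : Fin 1)).comp
      (ContinuousLinearMap.snd ℝ E (EuclideanSpace ℝ (Fin 1)))).contDiff
  · intro p _ r _
    simp [linearPhase, mul_assoc]
  · intro p hp h
    have h1 := congrArg (fun l => l (e, 0)) h
    rw [(hasFDerivAt_linearPhase hρ p).fderiv] at h1
    simp only [_root_.add_apply, _root_.smul_apply, ContinuousLinearMap.comp_apply,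
      ContinuousLinearMap.coe_fst', ContinuousLinearMap.coe_snd', he] at h1
    exact (euclideanOne_ne_zero_iff p.2).1 hp.2 (by simpa using h1)
  · intro p _
    rw [linearIndependent_unique_iff]
    intro h
    have h1 : (fun q => fderiv ℝ (linearPhase ρ) q
        (0, EuclideanSpace.single (default : Fin 1) 1)) = fun q => ρ q.1 := by
      ext q
      rw [fderiv_linearPhase_inr hρ]
      simp
    rw [h1] at h
    have h2 : HasFDerivAt (fun q : E × EuclideanSpace ℝ (Fin 1) => ρ q.1) _ p :=
      (hρ.differentiable (by simp) p.1).hasFDerivAt.comp p hasFDerivAt_fst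
    rw [h2.fderiv] at h
    have h3 := congrArg (fun l => l (e, 0)) h
    simp [he] at h3

/-- The image is the whole conormal bundle, whence the open set `univ`. Evaluating `θ dρ` at `e`
recovers `θ`, which gives injectivity. -/
lemma parametrizesOpenPiece_linearPhase (hρ : ContDiff ℝ ∞ ρ) {e : E}
    (he : ∀ z, fderiv ℝ ρ z e = -1) :
    ParametrizesOpenPiece (linearPhase ρ) (fullCone Ω (EuclideanSpace ℝ (Fin 1)))
      (conormalBundle Ω ρ) := by
  refine ⟨?_, univ, isOpen_univ, ?_⟩
  · rintro ⟨z, θ⟩ - ⟨z', θ'⟩ - h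
    simp only [spaceDifferential_linearPhase hρ, Prod.mk.injEq] at h
    obtain ⟨rfl, h2⟩ := h
    have h3 := congrArg (fun l => l e) h2
    simp only [_root_.smul_apply, he, smul_eq_mul, mul_neg, mul_one, neg_inj] at h3
    rw [Prod.mk.injEq]
    refine ⟨rfl, ?_⟩
    ext i
    fin_cases i
    exact h3
  · rw [criticalSet_linearPhase hρ, inter_univ]
    ext ⟨z, η⟩
    constructor
    · rintro ⟨⟨z', θ⟩, ⟨h1, h2, h3⟩, h4⟩
      simp only [spaceDifferential_linearPhase hρ, Prod.mk.injEq] at h4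
      obtain ⟨rfl, rfl⟩ := h4
      exact ⟨h1, h2, θ 0, (euclideanOne_ne_zero_iff θ).1 h3, rfl⟩
    · rintro ⟨h1, h2, w, hw, h3⟩
      refine ⟨(z, EuclideanSpace.single 0 w), ⟨h1, h2, ?_⟩, ?_⟩
      · rw [euclideanOne_ne_zero_iff]
        simpa using hw
      · simp only [spaceDifferential_linearPhase hρ, Prod.mk.injEq, true_and]
        simpa using h3.symm

lemma isConicallySupportedIn_fullCone (W : Type*) [NormedAddCommGroup W] [NormedSpace ℝ W]
    (a : E × W → ℂ) :
    IsConicallySupportedIn Ω a (fullCone Ω W) :=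
  ⟨_, univ, isClosed_univ, rfl, fun _ hp _ _ => ⟨mem_univ _, hp.2.1, mem_univ _⟩,
    fun _ hp h => ⟨hp.2.1, h⟩, fun _ hp _ => ⟨mem_univ _, hp, mem_univ _⟩⟩

variable [MeasureSpace E]

lemma isOscillatoryPiece_linearPhase (hρ : ContDiff ℝ ∞ ρ) {e : E}
    (he : ∀ z, fderiv ℝ ρ z e = -1) {m : ℝ}
    {a : E × EuclideanSpace ℝ (Fin 1) → ℂ}
    (ha : IsSymbol (m + ((Module.finrank ℝ E : ℝ) - 2 * (1 : ℕ)) / 4) Ω a) {K : 𝓓'(Ω, ℂ)}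
    (hK : ∀ u : 𝓓(Ω, ℝ), HasOscillatoryIntegral (linearPhase ρ) a u (K u)) :
    IsOscillatoryPiece m Ω (conormalBundle Ω ρ) 1 K :=
  ⟨linearPhase ρ, a, _, isNondegeneratePhase_linearPhase hρ he,
    parametrizesOpenPiece_linearPhase hρ he, ha, isConicallySupportedIn_fullCone _ a, hK⟩

lemma isOscillatoryPiece_zero (hρ : ContDiff ℝ ∞ ρ) {e : E}
    (he : ∀ z, fderiv ℝ ρ z e = -1) (m : ℝ) :
    IsOscillatoryPiece m Ω (conormalBundle Ω ρ) 1 (0 : 𝓓'(Ω, ℂ)) := by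
  refine isOscillatoryPiece_linearPhase hρ he (IsSymbol.zero _ _) fun u χ _ _ _ => ?_
  simp

/-- The locally finite sum is `K, 0, 0, …`, so the zero distribution must itself be a piece. -/
lemma IsOscillatoryPiece.isLagrangianDistribution {m : ℝ} {S : Set (E × StrongDual ℝ E)}
    {N : ℕ} (hN : 0 < N) {K : 𝓓'(Ω, ℂ)} (hK : IsOscillatoryPiece m Ω S N K)
    (h0 : IsOscillatoryPiece m Ω S N (0 : 𝓓'(Ω, ℂ))) : IsLagrangianDistribution m Ω S K := by
  refine ⟨fun j => if j = 0 then K else 0, fun L _ _ => ?_, fun u => ?_, fun j => ⟨N, hN, ?_⟩⟩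
  · refine (finite_singleton 0).subset ?_
    rintro j ⟨u, -, hu⟩
    by_contra hj
    rw [mem_singleton_iff] at hj
    simp [hj] at hu
  · rw [finsum_eq_single _ 0 fun j hj => by simp [hj]]
    simp
  · dsimp only
    split_ifs
    exacts [hK, h0]

end LinearPhase

/-! ## The distances and the travel time -/

section Distances

lemma dT_eq (α h s : ℝ) (x : ℝ × ℝ) : dT α h s x = √((x.1 - s - α) ^ 2 + x.2 ^ 2 + h ^ 2) := by
  rw [dT, EuclideanSpace.norm_eq]
  congr 1
  simp [Fin.sum_univ_three, ground, γT, sub_sub]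

lemma dR_eq_dT (α h s : ℝ) (x : ℝ × ℝ) : dR α h s x = dT (-α) h s x := by
  simp only [dR, dT, γR, γT, sub_eq_add_neg]

lemma dR_eq (α h s : ℝ) (x : ℝ × ℝ) : dR α h s x = √((x.1 - s + α) ^ 2 + x.2 ^ 2 + h ^ 2) := by
  rw [dR_eq_dT, dT_eq, sub_neg_eq_add]

variable {α h : ℝ}

lemma dT_pos (hh : 0 < h) (s : ℝ) (x : ℝ × ℝ) : 0 < dT α h s x := by
  rw [dT_eq]
  positivity

lemma dR_pos (hh : 0 < h) (s : ℝ) (x : ℝ × ℝ) : 0 < dR α h s x := by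
  rw [dR_eq_dT]
  exact dT_pos hh s x

lemma sq_dT (s : ℝ) (x : ℝ × ℝ) : dT α h s x ^ 2 = (x.1 - s - α) ^ 2 + x.2 ^ 2 + h ^ 2 := by
  rw [dT_eq, Real.sq_sqrt (by positivity)]

lemma sq_dR (s : ℝ) (x : ℝ × ℝ) : dR α h s x ^ 2 = (x.1 - s + α) ^ 2 + x.2 ^ 2 + h ^ 2 := by
  rw [dR_eq, Real.sq_sqrt (by positivity)]

variable {M : Type*} [NormedAddCommGroup M] [NormedSpace ℝ M] {s : M → ℝ} {x : M → ℝ × ℝ}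
  {n : WithTop ℕ∞}

lemma contDiff_dT (hh : 0 < h) (hs : ContDiff ℝ n s) (hx : ContDiff ℝ n x) :
    ContDiff ℝ n (fun p => dT α h (s p) (x p)) := by
  simp_rw [dT_eq]
  refine ContDiff.sqrt ?_ fun p => by positivity
  exact (((((contDiff_fst.comp hx).sub hs).sub contDiff_const).pow 2).add
    ((contDiff_snd.comp hx).pow 2)).add contDiff_const

lemma contDiff_dR (hh : 0 < h) (hs : ContDiff ℝ n s) (hx : ContDiff ℝ n x) :
    ContDiff ℝ n (fun p => dR α h (s p) (x p)) := by
  simp_rw [dR_eq_dT]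
  exact contDiff_dT hh hs hx

lemma hasFDerivAt_dT (hh : 0 < h) {s' : StrongDual ℝ M} {x' : M →L[ℝ] ℝ × ℝ} {p : M}
    (hs : HasFDerivAt s s' p) (hx : HasFDerivAt x x' p) :
    HasFDerivAt (fun p => dT α h (s p) (x p))
      ((dT α h (s p) (x p))⁻¹ • (((x p).1 - s p - α) •
        ((ContinuousLinearMap.fst ℝ ℝ ℝ).comp x' - s') +
          (x p).2 • (ContinuousLinearMap.snd ℝ ℝ ℝ).comp x')) p := by
  have h1 := (((hx.fst.sub hs).sub_const α).pow 2).add (hx.snd.pow 2) |>.add_const (h ^ 2)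
  have h2 := h1.sqrt
    (ne_of_gt (show 0 < ((x p).1 - s p - α) ^ 2 + (x p).2 ^ 2 + h ^ 2 by positivity))
  simp_rw [dT_eq]
  refine h2.congr_fderiv ?_
  ext v
  simp
  field_simp

lemma hasFDerivAt_dR (hh : 0 < h) {s' : StrongDual ℝ M} {x' : M →L[ℝ] ℝ × ℝ} {p : M}
    (hs : HasFDerivAt s s' p) (hx : HasFDerivAt x x' p) :
    HasFDerivAt (fun p => dR α h (s p) (x p))
      ((dR α h (s p) (x p))⁻¹ • (((x p).1 - s p + α) •
        ((ContinuousLinearMap.fst ℝ ℝ ℝ).comp x' - s') +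
          (x p).2 • (ContinuousLinearMap.snd ℝ ℝ ℝ).comp x')) p := by
  simp_rw [dR_eq_dT]
  have := hasFDerivAt_dT (α := -α) hh hs hx
  rwa [sub_neg_eq_add] at this

end Distances

/-! ## The canonical relation as a conormal bundle -/

section Relation

variable {c₀ α h : ℝ}

/-- The defining function `(d_T + d_R) / c₀ - t` of the incidence relation. -/
def incidence (c₀ α h : ℝ) (z : (ℝ × ℝ) × (ℝ × ℝ)) : ℝ :=
  1 / c₀ * (dT α h z.1.1 z.2 + dR α h z.1.1 z.2) - z.1.2

/-- The `x₁`-derivative of `d_T + d_R`. -/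
def rangeDeriv₁ (α h s : ℝ) (x : ℝ × ℝ) : ℝ :=
  (x.1 - s - α) / dT α h s x + (x.1 - s + α) / dR α h s x

/-- The `x₂`-derivative of `d_T + d_R`. -/
def rangeDeriv₂ (α h s : ℝ) (x : ℝ × ℝ) : ℝ := x.2 / dT α h s x + x.2 / dR α h s x

lemma contDiff_incidence (hh : 0 < h) : ContDiff ℝ ∞ (incidence c₀ α h) := by
  have hs : ContDiff ℝ ∞ fun z : (ℝ × ℝ) × (ℝ × ℝ) => z.1.1 := contDiff_fst.fst
  exact (contDiff_const.mul ((contDiff_dT hh hs contDiff_snd).add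
    (contDiff_dR hh hs contDiff_snd))).sub contDiff_fst.snd

/-- The covector of `Λ` in the data variables. -/
def dataCovector (c₀ α h w s : ℝ) (x : ℝ × ℝ) : StrongDual ℝ (ℝ × ℝ) :=
  covector (-(w / c₀) * rangeDeriv₁ α h s x) (-w)

/-- The covector of `Λ` in the ground variables. -/
def groundCovector (c₀ α h w s : ℝ) (x : ℝ × ℝ) : StrongDual ℝ (ℝ × ℝ) :=
  covector (-(w / c₀) * rangeDeriv₁ α h s x) (-(w / c₀) * rangeDeriv₂ α h s x)

lemma covector_apply (a b : ℝ) (y : ℝ × ℝ) : covector a b y = a * y.1 + b * y.2 := by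
  simp [covector]

lemma fderiv_incidence (hh : 0 < h) (z : (ℝ × ℝ) × (ℝ × ℝ)) :
    fderiv ℝ (incidence c₀ α h) z =
      (dataCovector c₀ α h 1 z.1.1 z.2).comp (ContinuousLinearMap.fst ℝ _ _) -
        (groundCovector c₀ α h 1 z.1.1 z.2).comp (ContinuousLinearMap.snd ℝ _ _) := by
  have hs : HasFDerivAt (fun z : (ℝ × ℝ) × (ℝ × ℝ) => z.1.1)
    ((ContinuousLinearMap.fst ℝ ℝ ℝ).comp (ContinuousLinearMap.fst ℝ (ℝ × ℝ) (ℝ × ℝ))) z :=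
      hasFDerivAt_fst.fst
  have ht : HasFDerivAt (fun z : (ℝ × ℝ) × (ℝ × ℝ) => z.1.2)
    ((ContinuousLinearMap.snd ℝ ℝ ℝ).comp (ContinuousLinearMap.fst ℝ (ℝ × ℝ) (ℝ × ℝ))) z :=
      hasFDerivAt_fst.snd
  have h1 := (((hasFDerivAt_dT (α := α) hh hs hasFDerivAt_snd).add
    (hasFDerivAt_dR (α := α) hh hs hasFDerivAt_snd)).const_mul (1 / c₀)).sub ht
  rw [show fderiv ℝ (incidence c₀ α h) z = _ from h1.fderiv]
  ext <;> simp [dataCovector, groundCovector, covector_apply, rangeDeriv₁, rangeDeriv₂] <;> ring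

lemma fderiv_incidence_time (hh : 0 < h) (z : (ℝ × ℝ) × (ℝ × ℝ)) :
    fderiv ℝ (incidence c₀ α h) z ((0, 1), 0) = -1 := by
  simp [fderiv_incidence hh, dataCovector, covector_apply]

lemma twisted_covector (hh : 0 < h) (w : ℝ) (z : (ℝ × ℝ) × (ℝ × ℝ)) :
    (dataCovector c₀ α h w z.1.1 z.2).comp (ContinuousLinearMap.fst ℝ _ _) -
        (groundCovector c₀ α h w z.1.1 z.2).comp (ContinuousLinearMap.snd ℝ _ _) =
      w • fderiv ℝ (incidence c₀ α h) z := by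
  rw [fderiv_incidence hh]
  ext <;> simp [dataCovector, groundCovector, covector_apply] <;> ring

lemma parametrization_eq (v : (ℝ × ℝ) × (ℝ × ℝ)) : parametrization c₀ α h v =
    (((v.2.1, 1 / c₀ * (dT α h v.2.1 v.1 + dR α h v.2.1 v.1)),
        dataCovector c₀ α h v.2.2 v.2.1 v.1),
      (v.1, groundCovector c₀ α h v.2.2 v.2.1 v.1)) := rfl

lemma image_parametrization (hc₀ : 0 < c₀) (D : Opens (ℝ × ℝ)) :
    parametrization c₀ α h '' parameterDomain c₀ α h D = canonicalRelation c₀ α h D := by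
  ext q
  constructor
  · rintro ⟨v, ⟨h1, h2⟩, rfl⟩
    refine ⟨v.2.1, 1 / c₀ * (dT α h v.2.1 v.1 + dR α h v.2.1 v.1), v.1.1, v.1.2, v.2.2, h1, h2,
      ?_, rfl⟩
    rw [dT_eq, dR_eq]
    field_simp
  · rintro ⟨s, t, x₁, x₂, w, h1, h2, h3, rfl⟩
    have h4 : t = 1 / c₀ * (dT α h s (x₁, x₂) + dR α h s (x₁, x₂)) := by
      rw [dT_eq, dR_eq, ← h3]
      field_simp
    subst h4
    exact ⟨((x₁, x₂), (s, w)), ⟨h1, h2⟩, rfl⟩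

lemma contDiff_rangeDeriv₁ {M : Type*} [NormedAddCommGroup M] [NormedSpace ℝ M] {s : M → ℝ}
    {x : M → ℝ × ℝ} {n : WithTop ℕ∞} (hh : 0 < h) (hs : ContDiff ℝ n s) (hx : ContDiff ℝ n x) :
    ContDiff ℝ n (fun p => rangeDeriv₁ α h (s p) (x p)) :=
  ((((contDiff_fst.comp hx).sub hs).sub contDiff_const).div (contDiff_dT hh hs hx)
    fun _ => (dT_pos hh _ _).ne').add
    ((((contDiff_fst.comp hx).sub hs).add contDiff_const).div (contDiff_dR hh hs hx)
    fun _ => (dR_pos hh _ _).ne')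

lemma contDiff_rangeDeriv₂ {M : Type*} [NormedAddCommGroup M] [NormedSpace ℝ M] {s : M → ℝ}
    {x : M → ℝ × ℝ} {n : WithTop ℕ∞} (hh : 0 < h) (hs : ContDiff ℝ n s) (hx : ContDiff ℝ n x) :
    ContDiff ℝ n (fun p => rangeDeriv₂ α h (s p) (x p)) :=
  ((contDiff_snd.comp hx).div (contDiff_dT hh hs hx) fun _ => (dT_pos hh _ _).ne').add
    ((contDiff_snd.comp hx).div (contDiff_dR hh hs hx) fun _ => (dR_pos hh _ _).ne')

lemma contDiff_covector {M : Type*} [NormedAddCommGroup M] [NormedSpace ℝ M] {a b : M → ℝ}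
    {n : WithTop ℕ∞} (ha : ContDiff ℝ n a) (hb : ContDiff ℝ n b) :
    ContDiff ℝ n (fun p => covector (a p) (b p)) :=
  (ha.smul contDiff_const).add (hb.smul contDiff_const)

lemma contDiff_travelTime (hh : 0 < h) : ContDiff ℝ ∞ fun v : (ℝ × ℝ) × (ℝ × ℝ) =>
    1 / c₀ * (dT α h v.2.1 v.1 + dR α h v.2.1 v.1) :=
  contDiff_const.mul ((contDiff_dT hh contDiff_snd.fst contDiff_fst).add
    (contDiff_dR hh contDiff_snd.fst contDiff_fst))

lemma contDiff_parametrization (hh : 0 < h) : ContDiff ℝ ∞ (parametrization c₀ α h) := by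
  have hs : ContDiff ℝ ∞ fun v : (ℝ × ℝ) × (ℝ × ℝ) => v.2.1 := contDiff_snd.fst
  have hw : ContDiff ℝ ∞ fun v : (ℝ × ℝ) × (ℝ × ℝ) => v.2.2 := contDiff_snd.snd
  have h1 : ContDiff ℝ ∞ fun v : (ℝ × ℝ) × (ℝ × ℝ) => -(v.2.2 / c₀) * rangeDeriv₁ α h v.2.1 v.1 :=
    (hw.div_const c₀).neg.mul (contDiff_rangeDeriv₁ hh hs contDiff_fst)
  have h2 : ContDiff ℝ ∞ fun v : (ℝ × ℝ) × (ℝ × ℝ) => -(v.2.2 / c₀) * rangeDeriv₂ α h v.2.1 v.1 :=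
    (hw.div_const c₀).neg.mul (contDiff_rangeDeriv₂ hh hs contDiff_fst)
  exact ((hs.prodMk (contDiff_travelTime hh)).prodMk (contDiff_covector h1 hw.neg)).prodMk
    (contDiff_fst.prodMk (contDiff_covector h1 h2))

lemma isOpen_parameterDomain (hh : 0 < h) (D : Opens (ℝ × ℝ)) :
    IsOpen (parameterDomain c₀ α h D) :=
  (D.isOpen.preimage (continuous_snd.fst.prodMk (contDiff_travelTime hh).continuous)).inter
    (isOpen_ne_fun continuous_snd.snd continuous_const)

/-- The left inverse is linear and defined everywhere: `x` and `s` are base coordinates, and `ω` is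
minus the `t`-component of the data covector. -/
lemma isSmoothParametrization_parametrization (hc₀ : 0 < c₀) (hh : 0 < h) (D : Opens (ℝ × ℝ)) :
    IsSmoothParametrization (parametrization c₀ α h) (parameterDomain c₀ α h D)
      (canonicalRelation c₀ α h D) := by
  refine ⟨isOpen_parameterDomain hh D, (contDiff_parametrization hh).contDiffOn,
    image_parametrization hc₀ D, univ, fun q => (q.2.1, (q.1.1.1, -q.1.2 (0, 1))), isOpen_univ,
    subset_univ _, ContDiff.contDiffOn ?_, fun v _ => ?_⟩
  · exact contDiff_snd.fst.prodMk (contDiff_fst.fst.fst.prodMk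
      (contDiff_fst.snd.clm_apply contDiff_const).neg)
  · simp [parametrization_eq, dataCovector, covector_apply]

/-- The parametrization of the twisted relation. -/
def twistedParametrization (c₀ α h : ℝ) (v : (ℝ × ℝ) × (ℝ × ℝ)) :
    ((ℝ × ℝ) × (ℝ × ℝ)) × StrongDual ℝ ((ℝ × ℝ) × (ℝ × ℝ)) :=
  (((v.2.1, 1 / c₀ * (dT α h v.2.1 v.1 + dR α h v.2.1 v.1)), v.1),
    v.2.2 • fderiv ℝ (incidence c₀ α h)
      ((v.2.1, 1 / c₀ * (dT α h v.2.1 v.1 + dR α h v.2.1 v.1)), v.1))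

lemma twist_canonicalRelation_eq_image (hc₀ : 0 < c₀) (hh : 0 < h) (D : Opens (ℝ × ℝ)) :
    twist (canonicalRelation c₀ α h D) =
      twistedParametrization c₀ α h '' parameterDomain c₀ α h D := by
  rw [← image_parametrization hc₀, twist, image_image]
  refine image_congr fun v _ => ?_
  rw [parametrization_eq, twistedParametrization, ← twisted_covector hh]

/-- The twisted covector is `ω dρ`, and `ρ = 0` says exactly that `t` is the travel time. -/
lemma twist_canonicalRelation (hc₀ : 0 < c₀) (hh : 0 < h) (D : Opens (ℝ × ℝ)) :
    twist (canonicalRelation c₀ α h D) =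
      conormalBundle (prodOpens D ⊤) (incidence c₀ α h) := by
  rw [twist_canonicalRelation_eq_image hc₀ hh]
  ext ⟨⟨⟨s, t⟩, x⟩, η⟩
  constructor
  · rintro ⟨v, ⟨h1, h2⟩, h3⟩
    rw [← h3]
    exact ⟨⟨h1, mem_univ _⟩, sub_self _, v.2.2, h2, rfl⟩
  · rintro ⟨⟨h1, -⟩, h2, w, hw, h3⟩
    have h4 : t = 1 / c₀ * (dT α h s x + dR α h s x) := (sub_eq_zero.1 h2).symm
    subst h4
    exact ⟨(x, (s, w)), ⟨h1, hw⟩, Prod.ext rfl h3.symm⟩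

lemma isClosedConicLagrangian_twist (hc₀ : 0 < c₀) (hh : 0 < h) (D : Opens (ℝ × ℝ)) :
    IsClosedConicLagrangian (prodOpens D ⊤) (twist (canonicalRelation c₀ α h D)) := by
  have hρ : ContDiff ℝ ∞ (incidence c₀ α h) := contDiff_incidence hh
  have hz : ContDiff ℝ ∞ fun v : (ℝ × ℝ) × (ℝ × ℝ) =>
      ((v.2.1, 1 / c₀ * (dT α h v.2.1 v.1 + dR α h v.2.1 v.1)), v.1) :=
    (contDiff_snd.fst.prodMk (contDiff_travelTime hh)).prodMk contDiff_fst
  have hw : ContDiff ℝ ∞ fun v : (ℝ × ℝ) × (ℝ × ℝ) => v.2.2 := contDiff_snd.snd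
  have hsymp := symplecticForm_conormal_eq_zero hρ (hz.differentiable (by simp))
    (hw.differentiable (by simp)) (fun v => sub_self _)
  refine ⟨?_, ?_, fun p _ => ⟨univ, parameterDomain c₀ α h D, twistedParametrization c₀ α h,
    isOpen_univ, mem_univ _, ⟨isOpen_parameterDomain hh D, ContDiff.contDiffOn ?_, ?_, univ,
      fun q => (q.1.2, (q.1.1.1, -q.2 ((0, 1), 0))), isOpen_univ, subset_univ _,
        ContDiff.contDiffOn ?_, fun v _ => ?_⟩, fun u _ v w => hsymp u v w⟩⟩
  · rw [twist_canonicalRelation hc₀ hh]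
    exact conormalBundle_eq_inter hρ (fderiv_incidence_time hh)
  · intro p hp r hr
    rw [twist_canonicalRelation hc₀ hh] at hp ⊢
    exact conormalBundle_conic hp hr
  · exact hz.prodMk (hw.smul ((hρ.fderiv_right (by simp)).comp hz))
  · rw [inter_univ, twist_canonicalRelation_eq_image hc₀ hh]
  · exact contDiff_fst.snd.prodMk (contDiff_fst.fst.fst.prodMk
      (contDiff_snd.clm_apply contDiff_const).neg)
  · simp [twistedParametrization, fderiv_incidence_time hh]

end Relation

/-! ## The forward operator -/

section ForwardOperator

variable {c₀ α h : ℝ} {s₀ s₁ t₀ t₁ : EReal}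

lemma phase_eq (p : ((ℝ × ℝ) × (ℝ × ℝ)) × ℝ) :
    phase c₀ α h p = p.2 * incidence c₀ α h p.1 := by
  rw [phase, incidence]
  ring

lemma contDiff_phase (hh : 0 < h) : ContDiff ℝ ∞ (phase c₀ α h) := by
  rw [funext phase_eq]
  exact contDiff_snd.mul ((contDiff_incidence hh).comp contDiff_fst)

lemma fderiv_phase_time (hh : 0 < h) (p : ((ℝ × ℝ) × (ℝ × ℝ)) × ℝ) :
    fderiv ℝ (phase c₀ α h) p (((0, 1), 0), 0) = -p.2 := by
  have h1 : HasFDerivAt (fun p : ((ℝ × ℝ) × (ℝ × ℝ)) × ℝ => p.2 * incidence c₀ α h p.1) _ p :=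
    hasFDerivAt_snd.mul
      (((contDiff_incidence hh).differentiable (by simp) p.1).hasFDerivAt.comp p hasFDerivAt_fst)
  rw [funext phase_eq, h1.fderiv]
  simp [fderiv_incidence_time hh]

theorem exists_forwardOperator (hc₀ : 0 < c₀) (hh : 0 < h) {D : Opens (ℝ × ℝ)}
    {A : ((ℝ × ℝ) × (ℝ × ℝ)) × ℝ → ℂ} (hA : IsSymbol 2 (prodOpens D (⊤ : Opens (ℝ × ℝ))) A) :
    ∃ F : 𝓓((⊤ : Opens (ℝ × ℝ)), ℝ) →ₗ[ℝ] 𝓓'(D, ℂ),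
      IsForwardOperator c₀ α h A D F ∧
      IsFourierIntegralOperator (3 / 2) D ⊤ (canonicalRelation c₀ α h D) F := by
  have : (volume : Measure (ℝ × ℝ)).IsAddHaarMeasure := isAddHaarMeasure_volume_prod
  have : (volume : Measure ((ℝ × ℝ) × (ℝ × ℝ))).IsAddHaarMeasure := isAddHaarMeasure_volume_prod
  obtain ⟨K, hK4, hK⟩ := exists_oscillatory_distribution hA (contDiff_phase (c₀ := c₀) (α := α) hh)
    (fderiv_phase_time hh)
  obtain ⟨F, hF⟩ := hK4.exists_operator
  refine ⟨F, fun V u => ?_, isClosedConicLagrangian_twist hc₀ hh D, K, hF, ?_⟩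
  · rw [hF]
    exact hK (tensor u V)
  · rw [twist_canonicalRelation hc₀ hh]
    have hρ : ContDiff ℝ ∞ (incidence c₀ α h) := contDiff_incidence hh
    refine IsOscillatoryPiece.isLagrangianDistribution one_pos
      (isOscillatoryPiece_linearPhase hρ (fderiv_incidence_time hh)
        (a := fun p => A (p.1, euclideanOneEquiv p.2)) ?_ fun u => ?_)
      (isOscillatoryPiece_zero hρ (fderiv_incidence_time hh) _)
    -- The kernel lives in dimension `n = 4` and has `N = 1` phase variable, so order `3/2`
    -- corresponds to amplitudes of order 2.
    · have e : (3 / 2 : ℝ) + ((Module.finrank ℝ ((ℝ × ℝ) × (ℝ × ℝ)) : ℝ) - 2 * (1 : ℕ)) / 4 = 2 := by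
        simp only [Module.finrank_prod, Module.finrank_self]
        norm_num
      rw [e]
      exact hA.comp_linearIsometryEquiv euclideanOneEquiv
    · have := (hK u).comp_linearIsometryEquiv euclideanOneEquiv measurePreserving_euclideanOneEquiv
      simp only [phase_eq] at this
      exact this

lemma dataCovector_ne_zero {w : ℝ} (hw : w ≠ 0) (s : ℝ) (x : ℝ × ℝ) :
    dataCovector c₀ α h w s x ≠ 0 := by
  intro h1
  have h2 := congrArg (fun l => l (0, 1)) h1
  simp [dataCovector, covector_apply] at h2
  exact hw h2

/-- With `y = x₁ - s`, squaring `(y - α) R = -(y + α) T` cancels everything but `h² ((y - α)² - (y +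
α)²) = 0`. Hence `T = R`, and the unsquared equation gives `2 y R = 0`. -/
lemma rangeDeriv₁_eq_zero_iff (hh : 0 < h) {s x₁ : ℝ} :
    rangeDeriv₁ α h s (x₁, 0) = 0 ↔ x₁ = s := by
  have hT := dT_pos (α := α) hh s (x₁, 0)
  have hR := dR_pos (α := α) hh s (x₁, 0)
  have hT2 := sq_dT (α := α) (h := h) s (x₁, 0)
  have hR2 := sq_dR (α := α) (h := h) s (x₁, 0)
  have hRT : x₁ = s → dR α h s (x₁, 0) = dT α h s (x₁, 0) := by
    rintro rfl
    rw [dT_eq, dR_eq]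
    norm_num
  unfold rangeDeriv₁
  dsimp only at hT2 hR2 ⊢
  set T := dT α h s (x₁, 0)
  set R := dR α h s (x₁, 0)
  set y := x₁ - s with hy
  constructor
  · intro h0
    have h1 : (y - α) * R = -((y + α) * T) := by
      field_simp at h0
      linarith
    have h2 : (y - α) ^ 2 * R ^ 2 = (y + α) ^ 2 * T ^ 2 := by
      rw [← mul_pow, ← mul_pow, h1, neg_sq]
    rw [hT2, hR2] at h2
    have h3 : h ^ 2 * ((y - α) ^ 2 - (y + α) ^ 2) = 0 := by linear_combination h2
    have h4 : (y - α) ^ 2 = (y + α) ^ 2 := by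
      have := (mul_eq_zero.1 h3).resolve_left (by positivity)
      linarith
    have h5 : T = R := by
      have : T ^ 2 = R ^ 2 := by rw [hT2, hR2, h4]
      exact (sq_eq_sq₀ hT.le hR.le).1 this
    rw [h5] at h1
    have h6 : 2 * y * R = 0 := by linear_combination h1
    have : y = 0 := by
      have := (mul_eq_zero.1 h6).resolve_right hR.ne'
      linarith
    rw [hy] at this
    linarith
  · intro h0
    rw [hRT h0]
    have : y = 0 := by rw [hy, h0, sub_self]
    rw [this]
    ring

lemma rangeDeriv₂_eq_zero_iff (hh : 0 < h) {s : ℝ} {x : ℝ × ℝ} :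
    rangeDeriv₂ α h s x = 0 ↔ x.2 = 0 := by
  have hT := dT_pos (α := α) hh s x
  have hR := dR_pos (α := α) hh s x
  have h1 : rangeDeriv₂ α h s x = x.2 * ((dT α h s x)⁻¹ + (dR α h s x)⁻¹) := by
    rw [rangeDeriv₂]; ring
  have h2 : (dT α h s x)⁻¹ + (dR α h s x)⁻¹ ≠ 0 := by positivity
  rw [h1, mul_eq_zero, or_iff_left h2]

/-- The data covector has `t`-component `-ω ≠ 0`. The ground covector vanishes only at the point
under the midpoint, where `d_T = d_R = √(α² + h²)`, and that travel time is removed. -/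
theorem isHomogeneousCanonicalRelation_excised (hc₀ : 0 < c₀) (hh : 0 < h) :
    IsHomogeneousCanonicalRelation (excisedDataSpace c₀ α h s₀ s₁ t₀ t₁) ⊤
      (canonicalRelation c₀ α h (excisedDataSpace c₀ α h s₀ s₁ t₀ t₁)) := by
  refine ⟨fun q hq => ?_, isClosedConicLagrangian_twist hc₀ hh _⟩
  rw [← image_parametrization hc₀] at hq
  obtain ⟨⟨⟨x₁, x₂⟩, ⟨s, w⟩⟩, ⟨hD, hw⟩, rfl⟩ := hq
  rw [parametrization_eq]
  refine ⟨dataCovector_ne_zero hw _ _, fun h1 => ?_⟩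
  dsimp only [groundCovector] at h1 hw
  have hc : -(w / c₀) ≠ 0 := neg_ne_zero.2 (div_ne_zero hw hc₀.ne')
  have h2 := congrArg (fun l => l (0, 1)) h1
  have h3 := congrArg (fun l => l (1, 0)) h1
  simp only [covector_apply, mul_zero, mul_one, zero_add, add_zero, _root_.zero_apply, mul_eq_zero,
    hc, false_or] at h2 h3
  have h4 : x₂ = 0 := (rangeDeriv₂_eq_zero_iff hh).1 h2
  subst h4
  obtain rfl := (rangeDeriv₁_eq_zero_iff hh).1 h3
  refine hD.2 ?_
  dsimp only
  rw [dT_eq, dR_eq]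
  norm_num
  ring

end ForwardOperator

/-! ## Corank one singularities -/

section CorankOne

variable {M F : Type*} [NormedAddCommGroup M] [NormedSpace ℝ M] [FiniteDimensional ℝ M]
  [NormedAddCommGroup F] [NormedSpace ℝ F]

lemma isLocalDiffeomorphAt_of_hasFDerivAt_equiv {f : M → F} (hf : ContDiff ℝ ∞ f) {u : M}
    {f' : M ≃L[ℝ] F} (hu : HasFDerivAt f (f' : M →L[ℝ] F) u) :
    IsLocalDiffeomorphAt (modelWithCornersSelf ℝ M) (modelWithCornersSelf ℝ F) ∞ f u := by
  have : CompleteSpace M := FiniteDimensional.complete ℝ M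
  have hn : (∞ : WithTop ℕ∞) ≠ 0 := by simp
  -- The inverse function theorem gives smoothness of the inverse at one point. Shrinking the source
  -- to the open set of invertible differentials gives it at every point of the target.
  let O : Set M := {v | fderiv ℝ f v ∈ range ((↑) : (M ≃L[ℝ] F) → M →L[ℝ] F)}
  have hO : IsOpen O := ContinuousLinearEquiv.isOpen.preimage (hf.continuous_fderiv hn)
  let Φ := hf.contDiffAt.toOpenPartialHomeomorph f hu hn
  have hΦ : (Φ : M → F) = f := rfl
  let Ψ := Φ.restrOpen O hO
  have huΨ : u ∈ Ψ.source :=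
    ⟨hf.contDiffAt.mem_toOpenPartialHomeomorph_source hu hn, f', hu.fderiv.symm⟩
  refine ⟨⟨Ψ.toPartialEquiv, Ψ.open_source, Ψ.open_target, ?_, ?_⟩, huΨ, fun _ _ => rfl⟩
  · exact contMDiffOn_iff_contDiffOn.2 hf.contDiffOn
  · refine contMDiffOn_iff_contDiffOn.2 fun y hy => ContDiffAt.contDiffWithinAt ?_
    obtain ⟨l, hl⟩ := (Ψ.map_target hy).2
    refine Ψ.contDiffAt_symm hy (f₀' := l) ?_ hf.contDiffAt
    rw [hl]
    exact (hf.differentiable hn _).hasFDerivAt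

lemma isLocalDiffeomorphAt_of_det_ne_zero {f : M → F} (hf : ContDiff ℝ ∞ f) (e : F ≃L[ℝ] M)
    {u : M} (hdet : ((e : F →L[ℝ] M).comp (fderiv ℝ f u)).det ≠ 0) :
    IsLocalDiffeomorphAt (modelWithCornersSelf ℝ M) (modelWithCornersSelf ℝ F) ∞ f u := by
  refine isLocalDiffeomorphAt_of_hasFDerivAt_equiv hf (f' :=
    (ContinuousLinearMap.toContinuousLinearEquivOfDetNeZero _ hdet).trans e.symm) ?_
  refine (hf.differentiable (by simp) u).hasFDerivAt.congr_fderiv ?_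
  ext v
  simp

/-- At a zero of `l` the product rule leaves `c(u) l` as the differential of the determinant; the
rank comes from the one-dimensional kernel. -/
lemma dropsRankSimplyByOne_of_det_eq {f : M → F} (e : F ≃L[ℝ] M) {u k : M} {c : M → ℝ}
    {l : StrongDual ℝ M}
    (hdet : ∀ v, ((e : F →L[ℝ] M).comp (fderiv ℝ f v)).det = c v * l v)
    (hc : DifferentiableAt ℝ c u) (hcu : c u ≠ 0) (hlu : l u = 0) (hl : l ≠ 0)
    (hk : k ≠ 0) (hker : LinearMap.ker (fderiv ℝ f u).toLinearMap = Submodule.span ℝ {k}) :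
    DropsRankSimplyByOne f u := by
  refine ⟨?_, e, ?_⟩
  · have h1 := LinearMap.finrank_range_add_finrank_ker (fderiv ℝ f u).toLinearMap
    rwa [hker, finrank_span_singleton hk] at h1
  · have h1 : HasFDerivAt (fun v => c v * l v) _ u := hc.hasFDerivAt.mul l.hasFDerivAt
    rw [funext hdet, h1.fderiv, hlu, zero_smul, add_zero]
    exact smul_ne_zero hcu hl

end CorankOne

/-! ### Determinants of block triangular endomorphisms of `ℝ² × ℝ²`. -/

section Determinant

lemma toMatrix_real_prod_prod (A : (ℝ × ℝ) × (ℝ × ℝ) →ₗ[ℝ] (ℝ × ℝ) × (ℝ × ℝ)) :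
    LinearMap.toMatrix ((Module.Basis.finTwoProd ℝ).prod (Module.Basis.finTwoProd ℝ))
      ((Module.Basis.finTwoProd ℝ).prod (Module.Basis.finTwoProd ℝ)) A =
    Matrix.fromBlocks
      !![(A ((1, 0), 0)).1.1, (A ((0, 1), 0)).1.1; (A ((1, 0), 0)).1.2, (A ((0, 1), 0)).1.2]
      !![(A (0, (1, 0))).1.1, (A (0, (0, 1))).1.1; (A (0, (1, 0))).1.2, (A (0, (0, 1))).1.2]
      !![(A ((1, 0), 0)).2.1, (A ((0, 1), 0)).2.1; (A ((1, 0), 0)).2.2, (A ((0, 1), 0)).2.2]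
      !![(A (0, (1, 0))).2.1, (A (0, (0, 1))).2.1; (A (0, (1, 0))).2.2, (A (0, (0, 1))).2.2] := by
  ext i j
  rcases i with i | i <;> rcases j with j | j <;> fin_cases i <;> fin_cases j <;>
    simp [LinearMap.toMatrix_apply]

lemma det_of_block_upper (A : (ℝ × ℝ) × (ℝ × ℝ) →L[ℝ] (ℝ × ℝ) × (ℝ × ℝ))
    (hA : ∀ v : ℝ × ℝ, (A (v, 0)).2 = 0) :
    A.det = ((A ((1, 0), 0)).1.1 * (A ((0, 1), 0)).1.2 -
        (A ((0, 1), 0)).1.1 * (A ((1, 0), 0)).1.2) *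
      ((A (0, (1, 0))).2.1 * (A (0, (0, 1))).2.2 - (A (0, (0, 1))).2.1 * (A (0, (1, 0))).2.2) := by
  rw [ContinuousLinearMap.det, ← LinearMap.det_toMatrix
    ((Module.Basis.finTwoProd ℝ).prod (Module.Basis.finTwoProd ℝ)), toMatrix_real_prod_prod]
  have h0 : !![(A ((1, 0), 0)).2.1, (A ((0, 1), 0)).2.1; (A ((1, 0), 0)).2.2,
      (A ((0, 1), 0)).2.2] = 0 := by
    ext i j
    fin_cases i <;> fin_cases j <;> simp [hA]
  simp only [ContinuousLinearMap.coe_coe]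
  rw [h0, Matrix.det_fromBlocks_zero₂₁, Matrix.det_fin_two_of, Matrix.det_fin_two_of]

lemma det_of_block_lower (A : (ℝ × ℝ) × (ℝ × ℝ) →L[ℝ] (ℝ × ℝ) × (ℝ × ℝ))
    (hA : ∀ v : ℝ × ℝ, (A (0, v)).1 = 0) :
    A.det = ((A ((1, 0), 0)).1.1 * (A ((0, 1), 0)).1.2 -
        (A ((0, 1), 0)).1.1 * (A ((1, 0), 0)).1.2) *
      ((A (0, (1, 0))).2.1 * (A (0, (0, 1))).2.2 - (A (0, (0, 1))).2.1 * (A (0, (1, 0))).2.2) := by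
  rw [ContinuousLinearMap.det, ← LinearMap.det_toMatrix
    ((Module.Basis.finTwoProd ℝ).prod (Module.Basis.finTwoProd ℝ)), toMatrix_real_prod_prod]
  have h0 : !![(A (0, (1, 0))).1.1, (A (0, (0, 1))).1.1; (A (0, (1, 0))).1.2,
      (A (0, (0, 1))).1.2] = 0 := by
    ext i j
    fin_cases i <;> fin_cases j <;> simp [hA]
  simp only [ContinuousLinearMap.coe_coe]
  rw [h0, Matrix.det_fromBlocks_zero₁₂, Matrix.det_fin_two_of, Matrix.det_fin_two_of]

end Determinant

/-! ## The projections of the canonical relation -/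

section Derivatives

variable {c₀ α h : ℝ}

/-- The second `x₁`-derivative of `d_T + d_R`. -/
def rangeHess₁₁ (α h s : ℝ) (x : ℝ × ℝ) : ℝ :=
  (x.2 ^ 2 + h ^ 2) * ((dT α h s x ^ 3)⁻¹ + (dR α h s x ^ 3)⁻¹)

/-- The mixed second derivative of `d_T + d_R` is `-x₂` times this function. -/
def rangeHess₁₂ (α h s : ℝ) (x : ℝ × ℝ) : ℝ :=
  (x.1 - s - α) / dT α h s x ^ 3 + (x.1 - s + α) / dR α h s x ^ 3

/-- The second `x₂`-derivative of `d_T + d_R`. -/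
def rangeHess₂₂ (α h s : ℝ) (x : ℝ × ℝ) : ℝ :=
  ((x.1 - s - α) ^ 2 + h ^ 2) / dT α h s x ^ 3 + ((x.1 - s + α) ^ 2 + h ^ 2) / dR α h s x ^ 3

/-- The coordinate `s` of `Λ`. -/
abbrev coordS : StrongDual ℝ ((ℝ × ℝ) × (ℝ × ℝ)) :=
  (ContinuousLinearMap.fst ℝ ℝ ℝ).comp (ContinuousLinearMap.snd ℝ (ℝ × ℝ) (ℝ × ℝ))

/-- The coordinate `ω` of `Λ`. -/
abbrev coordFreq : StrongDual ℝ ((ℝ × ℝ) × (ℝ × ℝ)) :=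
  (ContinuousLinearMap.snd ℝ ℝ ℝ).comp (ContinuousLinearMap.snd ℝ (ℝ × ℝ) (ℝ × ℝ))

/-- The differential of `x₁ - s`. -/
abbrev coordOffset : StrongDual ℝ ((ℝ × ℝ) × (ℝ × ℝ)) :=
  (ContinuousLinearMap.fst ℝ ℝ ℝ).comp (ContinuousLinearMap.fst ℝ (ℝ × ℝ) (ℝ × ℝ)) - coordS

/-- The coordinate `x₂` of `Λ`. -/
abbrev coordX₂ : StrongDual ℝ ((ℝ × ℝ) × (ℝ × ℝ)) :=
  (ContinuousLinearMap.snd ℝ ℝ ℝ).comp (ContinuousLinearMap.fst ℝ (ℝ × ℝ) (ℝ × ℝ))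

lemma hasFDerivAt_dT_coord (hh : 0 < h) (v : (ℝ × ℝ) × (ℝ × ℝ)) :
    HasFDerivAt (fun v : (ℝ × ℝ) × (ℝ × ℝ) => dT α h v.2.1 v.1)
      ((dT α h v.2.1 v.1)⁻¹ • ((v.1.1 - v.2.1 - α) • coordOffset + v.1.2 • coordX₂)) v :=
  hasFDerivAt_dT hh coordS.hasFDerivAt hasFDerivAt_fst

lemma hasFDerivAt_dR_coord (hh : 0 < h) (v : (ℝ × ℝ) × (ℝ × ℝ)) :
    HasFDerivAt (fun v : (ℝ × ℝ) × (ℝ × ℝ) => dR α h v.2.1 v.1)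
      ((dR α h v.2.1 v.1)⁻¹ • ((v.1.1 - v.2.1 + α) • coordOffset + v.1.2 • coordX₂)) v :=
  hasFDerivAt_dR hh coordS.hasFDerivAt hasFDerivAt_fst

lemma hasFDerivAt_range (hh : 0 < h) (v : (ℝ × ℝ) × (ℝ × ℝ)) :
    HasFDerivAt (fun v : (ℝ × ℝ) × (ℝ × ℝ) => dT α h v.2.1 v.1 + dR α h v.2.1 v.1)
      (rangeDeriv₁ α h v.2.1 v.1 • coordOffset + rangeDeriv₂ α h v.2.1 v.1 • coordX₂) v := by
  refine ((hasFDerivAt_dT_coord hh v).add (hasFDerivAt_dR_coord hh v)).congr_fderiv ?_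
  ext <;> simp [rangeDeriv₁, rangeDeriv₂] <;> ring

/-- Here `τ` stands for half the differential of `T²`, which is linear in the coordinate
differentials when `T` is a distance. -/
lemma hasFDerivAt_div_dist {M : Type*} [NormedAddCommGroup M] [NormedSpace ℝ M] {q T : M → ℝ}
    {q' τ : StrongDual ℝ M} {v : M} (hq : HasFDerivAt q q' v)
    (hT : HasFDerivAt T ((T v)⁻¹ • τ) v) (hT0 : T v ≠ 0) :
    HasFDerivAt (fun v => q v / T v) ((T v)⁻¹ • q' - (q v / T v ^ 3) • τ) v := by
  have h1 : HasFDerivAt (fun v => (T v)⁻¹) (-(T v ^ 2)⁻¹ • ((T v)⁻¹ • τ)) v :=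
    (hasDerivAt_inv hT0).comp_hasFDerivAt v hT
  simp_rw [div_eq_mul_inv (q _)]
  refine (hq.mul h1).congr_fderiv ?_
  ext w
  simp only [_root_.add_apply, _root_.sub_apply, _root_.smul_apply, smul_eq_mul]
  field_simp
  ring

lemma hasFDerivAt_rangeDeriv₁ (hh : 0 < h) (v : (ℝ × ℝ) × (ℝ × ℝ)) :
    HasFDerivAt (fun v : (ℝ × ℝ) × (ℝ × ℝ) => rangeDeriv₁ α h v.2.1 v.1)
      (rangeHess₁₁ α h v.2.1 v.1 • coordOffset -
        (v.1.2 * rangeHess₁₂ α h v.2.1 v.1) • coordX₂) v := by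
  have hT := dT_pos (α := α) hh v.2.1 v.1
  have hR := dR_pos (α := α) hh v.2.1 v.1
  have hT2 := sq_dT (α := α) (h := h) v.2.1 v.1
  have hR2 := sq_dR (α := α) (h := h) v.2.1 v.1
  have ha : HasFDerivAt (fun v : (ℝ × ℝ) × (ℝ × ℝ) => v.1.1 - v.2.1) coordOffset v :=
    coordOffset.hasFDerivAt
  refine ((hasFDerivAt_div_dist (ha.sub_const α) (hasFDerivAt_dT_coord hh v) hT.ne').add
    (hasFDerivAt_div_dist (ha.add_const α) (hasFDerivAt_dR_coord hh v) hR.ne')).congr_fderiv ?_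
  -- From `T² - a² = x₂² + h²` for `a = x₁ - s - α`, and likewise for `R`.
  have e3 : rangeHess₁₁ α h v.2.1 v.1 = (dT α h v.2.1 v.1)⁻¹ -
      (v.1.1 - v.2.1 - α) ^ 2 / dT α h v.2.1 v.1 ^ 3 + ((dR α h v.2.1 v.1)⁻¹ -
      (v.1.1 - v.2.1 + α) ^ 2 / dR α h v.2.1 v.1 ^ 3) := by
    rw [rangeHess₁₁, mul_add]
    congr 1
    · field_simp
      linarith
    · field_simp
      linarith
  rw [e3, rangeHess₁₂]
  ext <;>
    simp only [_root_.add_apply, _root_.sub_apply, _root_.smul_apply, smul_eq_mul,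
      ContinuousLinearMap.comp_apply] <;>
    ring

lemma hasFDerivAt_rangeDeriv₂ (hh : 0 < h) (v : (ℝ × ℝ) × (ℝ × ℝ)) :
    HasFDerivAt (fun v : (ℝ × ℝ) × (ℝ × ℝ) => rangeDeriv₂ α h v.2.1 v.1)
      (-(v.1.2 * rangeHess₁₂ α h v.2.1 v.1) • coordOffset +
        rangeHess₂₂ α h v.2.1 v.1 • coordX₂) v := by
  have hT := dT_pos (α := α) hh v.2.1 v.1
  have hR := dR_pos (α := α) hh v.2.1 v.1
  have hT2 := sq_dT (α := α) (h := h) v.2.1 v.1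
  have hR2 := sq_dR (α := α) (h := h) v.2.1 v.1
  have hx : HasFDerivAt (fun v : (ℝ × ℝ) × (ℝ × ℝ) => v.1.2) coordX₂ v := coordX₂.hasFDerivAt
  refine ((hasFDerivAt_div_dist hx (hasFDerivAt_dT_coord hh v) hT.ne').add
    (hasFDerivAt_div_dist hx (hasFDerivAt_dR_coord hh v) hR.ne')).congr_fderiv ?_
  have e3 : rangeHess₂₂ α h v.2.1 v.1 = (dT α h v.2.1 v.1)⁻¹ -
      v.1.2 ^ 2 / dT α h v.2.1 v.1 ^ 3 + ((dR α h v.2.1 v.1)⁻¹ -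
      v.1.2 ^ 2 / dR α h v.2.1 v.1 ^ 3) := by
    rw [rangeHess₂₂]
    congr 1
    · field_simp
      linarith
    · field_simp
      linarith
  rw [e3, rangeHess₁₂]
  ext <;>
    simp only [_root_.add_apply, _root_.sub_apply, _root_.smul_apply, smul_eq_mul,
      ContinuousLinearMap.comp_apply] <;>
    ring

/-- The function `Q` for which `-(ω / c₀²) x₂ Q` is the determinant of both projections. -/
def jacobianFactor (α h s : ℝ) (x : ℝ × ℝ) : ℝ :=
  rangeDeriv₁ α h s x * rangeHess₁₂ α h s x +
    ((dT α h s x)⁻¹ + (dR α h s x)⁻¹) * rangeHess₁₁ α h s x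

/-- With `a, b = x₁ - s ∓ α` and `H = x₂² + h²`, one finds `Q = (T² + R²)(TR + ab + H)/(T³R³)`. Here
`ab + H` is the inner product of `x - γ_T` and `x - γ_R`, and `(TR)² - (ab + H)² = 4α²H > 0`: the
two vectors are not parallel, so `ab + H > -TR`. -/
lemma jacobianFactor_pos (hα : 0 < α) (hh : 0 < h) (s : ℝ) (x : ℝ × ℝ) :
    0 < jacobianFactor α h s x := by
  have hT := dT_pos (α := α) hh s x
  have hR := dR_pos (α := α) hh s x
  have hT2 := sq_dT (α := α) (h := h) s x
  have hR2 := sq_dR (α := α) (h := h) s x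
  rw [jacobianFactor, rangeDeriv₁, rangeHess₁₂, rangeHess₁₁]
  generalize dT α h s x = T at *
  generalize dR α h s x = R at *
  have hH : 0 < x.2 ^ 2 + h ^ 2 := by positivity
  obtain ⟨a, ha⟩ : ∃ a, a = x.1 - s - α := ⟨_, rfl⟩
  obtain ⟨b, hb⟩ : ∃ b, b = x.1 - s + α := ⟨_, rfl⟩
  have hab : b - a = 2 * α := by rw [ha, hb]; ring
  rw [← ha, ← hb]
  rw [← ha, add_assoc] at hT2
  rw [← hb, add_assoc] at hR2
  generalize x.2 ^ 2 + h ^ 2 = H at *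
  have h1 : (T * R) ^ 2 = (a * b + H) ^ 2 + H * (b - a) ^ 2 := by
    rw [mul_pow, hT2, hR2]
    ring
  have h2 : 0 < H * (b - a) ^ 2 := by
    rw [hab]
    positivity
  have h3 : 0 < T * R + (a * b + H) := by
    linarith [(abs_lt.1 (abs_lt_of_sq_lt_sq (show (a * b + H) ^ 2 < (T * R) ^ 2 by linarith)
      (by positivity))).1]
  have h4 : (a / T + b / R) * (a / T ^ 3 + b / R ^ 3) +
      (T⁻¹ + R⁻¹) * (H * ((T ^ 3)⁻¹ + (R ^ 3)⁻¹)) =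
      (T ^ 2 + R ^ 2) * (T * R + (a * b + H)) / (T ^ 3 * R ^ 3) := by
    have e1 : (a * R + b * T) * (a * R ^ 3 + b * T ^ 3) + H * (R + T) * (R ^ 3 + T ^ 3) =
        T * R * ((T ^ 2 + R ^ 2) * (T * R + (a * b + H))) := by
      -- After expansion, `a² + H = T²` multiplies `R⁴` and `b² + H = R²` multiplies `T⁴`.
      linear_combination (-R ^ 4) * hT2 - T ^ 4 * hR2
    calc _ = ((a * R + b * T) * (a * R ^ 3 + b * T ^ 3) + H * (R + T) * (R ^ 3 + T ^ 3)) /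
          (T * R * (T ^ 3 * R ^ 3)) := by field_simp
      _ = _ := by rw [e1]; field_simp
  rw [h4]
  positivity

end Derivatives

/-! ### Differentials and determinants of the projections, and the fold. -/

section Projections

variable {c₀ α h : ℝ}

/-- Linear coordinates `(t, σ; s, τ)` of `(s, t; σ, τ) ∈ T*ℝ²`. -/
def leftCoordinates : ((ℝ × ℝ) × StrongDual ℝ (ℝ × ℝ)) ≃L[ℝ] (ℝ × ℝ) × (ℝ × ℝ) :=
  LinearEquiv.toContinuousLinearEquiv
    { toFun := fun p => ((p.1.2, p.2 (1, 0)), (p.1.1, p.2 (0, 1)))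
      invFun := fun q => ((q.2.1, q.1.1), covector q.1.2 q.2.2)
      map_add' := fun _ _ => rfl
      map_smul' := fun _ _ => rfl
      left_inv := fun p => by
        refine Prod.ext rfl ?_
        ext <;> simp [covector_apply]
      right_inv := fun q => by simp [covector_apply] }

lemma leftCoordinates_apply (p : (ℝ × ℝ) × StrongDual ℝ (ℝ × ℝ)) :
    leftCoordinates p = ((p.1.2, p.2 (1, 0)), (p.1.1, p.2 (0, 1))) := rfl

/-- Linear coordinates `(x₁, x₂; ξ₁, ξ₂)` of `T*ℝ²`. -/
def rightCoordinates : ((ℝ × ℝ) × StrongDual ℝ (ℝ × ℝ)) ≃L[ℝ] (ℝ × ℝ) × (ℝ × ℝ) :=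
  LinearEquiv.toContinuousLinearEquiv
    { toFun := fun p => (p.1, (p.2 (1, 0), p.2 (0, 1)))
      invFun := fun q => (q.1, covector q.2.1 q.2.2)
      map_add' := fun _ _ => rfl
      map_smul' := fun _ _ => rfl
      left_inv := fun p => by
        refine Prod.ext rfl ?_
        ext <;> simp [covector_apply]
      right_inv := fun q => by simp [covector_apply] }

lemma rightCoordinates_apply (p : (ℝ × ℝ) × StrongDual ℝ (ℝ × ℝ)) :
    rightCoordinates p = (p.1, (p.2 (1, 0), p.2 (0, 1))) := rfl

/-- The differential of the travel time. -/
def timeDifferential (c₀ α h : ℝ) (v : (ℝ × ℝ) × (ℝ × ℝ)) : StrongDual ℝ ((ℝ × ℝ) × (ℝ × ℝ)) :=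
  (1 / c₀) • (rangeDeriv₁ α h v.2.1 v.1 • coordOffset + rangeDeriv₂ α h v.2.1 v.1 • coordX₂)

/-- The differential of the component `σ = ξ₁` of the covectors of `Λ`. -/
def momentumDifferential₁ (c₀ α h : ℝ) (v : (ℝ × ℝ) × (ℝ × ℝ)) :
    StrongDual ℝ ((ℝ × ℝ) × (ℝ × ℝ)) :=
  -(1 / c₀) • (rangeDeriv₁ α h v.2.1 v.1 • coordFreq +
    v.2.2 • (rangeHess₁₁ α h v.2.1 v.1 • coordOffset -
      (v.1.2 * rangeHess₁₂ α h v.2.1 v.1) • coordX₂))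

/-- The differential of the component `ξ₂` of the covectors of `Λ`. -/
def momentumDifferential₂ (c₀ α h : ℝ) (v : (ℝ × ℝ) × (ℝ × ℝ)) :
    StrongDual ℝ ((ℝ × ℝ) × (ℝ × ℝ)) :=
  -(1 / c₀) • (rangeDeriv₂ α h v.2.1 v.1 • coordFreq +
    v.2.2 • (-(v.1.2 * rangeHess₁₂ α h v.2.1 v.1) • coordOffset +
      rangeHess₂₂ α h v.2.1 v.1 • coordX₂))

lemma timeDifferential_apply (v w : (ℝ × ℝ) × (ℝ × ℝ)) : timeDifferential c₀ α h v w =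
    1 / c₀ * (rangeDeriv₁ α h v.2.1 v.1 * (w.1.1 - w.2.1) + rangeDeriv₂ α h v.2.1 v.1 * w.1.2) :=
  rfl

lemma momentumDifferential₁_apply (v w : (ℝ × ℝ) × (ℝ × ℝ)) : momentumDifferential₁ c₀ α h v w =
    -(1 / c₀) * (rangeDeriv₁ α h v.2.1 v.1 * w.2.2 + v.2.2 *
      (rangeHess₁₁ α h v.2.1 v.1 * (w.1.1 - w.2.1) -
        v.1.2 * rangeHess₁₂ α h v.2.1 v.1 * w.1.2)) := rfl

lemma momentumDifferential₂_apply (v w : (ℝ × ℝ) × (ℝ × ℝ)) : momentumDifferential₂ c₀ α h v w =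
    -(1 / c₀) * (rangeDeriv₂ α h v.2.1 v.1 * w.2.2 + v.2.2 *
      (-(v.1.2 * rangeHess₁₂ α h v.2.1 v.1) * (w.1.1 - w.2.1) +
        rangeHess₂₂ α h v.2.1 v.1 * w.1.2)) := rfl

lemma hasFDerivAt_time (hh : 0 < h) (v : (ℝ × ℝ) × (ℝ × ℝ)) :
    HasFDerivAt (fun v : (ℝ × ℝ) × (ℝ × ℝ) => 1 / c₀ * (dT α h v.2.1 v.1 + dR α h v.2.1 v.1))
      (timeDifferential c₀ α h v) v :=
  (hasFDerivAt_range hh v).const_mul (1 / c₀)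

lemma hasFDerivAt_momentum {f : (ℝ × ℝ) × (ℝ × ℝ) → ℝ} {f' : StrongDual ℝ ((ℝ × ℝ) × (ℝ × ℝ))}
    {v : (ℝ × ℝ) × (ℝ × ℝ)} (hf : HasFDerivAt f f' v) :
    HasFDerivAt (fun v => -(v.2.2 / c₀) * f v) (-(1 / c₀) • (f v • coordFreq + v.2.2 • f')) v := by
  have hw : HasFDerivAt (fun v : (ℝ × ℝ) × (ℝ × ℝ) => v.2.2) coordFreq v := coordFreq.hasFDerivAt
  have h1 := (hw.mul hf).const_mul (-(1 / c₀))
  have h2 : (fun v : (ℝ × ℝ) × (ℝ × ℝ) => -(v.2.2 / c₀) * f v) =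
      fun v => -(1 / c₀) * (v.2.2 * f v) := by
    ext v
    ring
  rw [h2]
  refine h1.congr_fderiv ?_
  rw [add_comm]

lemma hasFDerivAt_momentum₁ (hh : 0 < h) (v : (ℝ × ℝ) × (ℝ × ℝ)) :
    HasFDerivAt (fun v : (ℝ × ℝ) × (ℝ × ℝ) => -(v.2.2 / c₀) * rangeDeriv₁ α h v.2.1 v.1)
      (momentumDifferential₁ c₀ α h v) v :=
  hasFDerivAt_momentum (hasFDerivAt_rangeDeriv₁ hh v)

lemma hasFDerivAt_momentum₂ (hh : 0 < h) (v : (ℝ × ℝ) × (ℝ × ℝ)) :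
    HasFDerivAt (fun v : (ℝ × ℝ) × (ℝ × ℝ) => -(v.2.2 / c₀) * rangeDeriv₂ α h v.2.1 v.1)
      (momentumDifferential₂ c₀ α h v) v :=
  hasFDerivAt_momentum (hasFDerivAt_rangeDeriv₂ hh v)

lemma contDiff_piL (hh : 0 < h) : ContDiff ℝ ∞ (piL c₀ α h) :=
  contDiff_fst.comp (contDiff_parametrization hh)

lemma contDiff_piR (hh : 0 < h) : ContDiff ℝ ∞ (piR c₀ α h) :=
  contDiff_snd.comp (contDiff_parametrization hh)

lemma leftCoordinates_comp_fderiv_piL (hh : 0 < h) (v : (ℝ × ℝ) × (ℝ × ℝ)) :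
    (leftCoordinates : _ →L[ℝ] (ℝ × ℝ) × (ℝ × ℝ)).comp (fderiv ℝ (piL c₀ α h) v) =
      ((timeDifferential c₀ α h v).prod (momentumDifferential₁ c₀ α h v)).prod
        (coordS.prod (-coordFreq)) := by
  have h1 : leftCoordinates ∘ piL c₀ α h = fun v =>
      ((1 / c₀ * (dT α h v.2.1 v.1 + dR α h v.2.1 v.1),
        -(v.2.2 / c₀) * rangeDeriv₁ α h v.2.1 v.1), (v.2.1, -v.2.2)) := by
    ext v <;> simp [leftCoordinates_apply, piL, parametrization_eq, dataCovector, covector_apply]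
  have h2 := ((hasFDerivAt_time (c₀ := c₀) (α := α) hh v).prodMk
    (hasFDerivAt_momentum₁ (c₀ := c₀) (α := α) hh v)).prodMk
      (coordS.hasFDerivAt.prodMk (coordFreq.hasFDerivAt (x := v)).neg)
  rw [← ContinuousLinearEquiv.comp_fderiv, h1]
  exact h2.fderiv

lemma rightCoordinates_comp_fderiv_piR (hh : 0 < h) (v : (ℝ × ℝ) × (ℝ × ℝ)) :
    (rightCoordinates : _ →L[ℝ] (ℝ × ℝ) × (ℝ × ℝ)).comp (fderiv ℝ (piR c₀ α h) v) =
      (ContinuousLinearMap.fst ℝ (ℝ × ℝ) (ℝ × ℝ)).prod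
        ((momentumDifferential₁ c₀ α h v).prod (momentumDifferential₂ c₀ α h v)) := by
  have h1 : rightCoordinates ∘ piR c₀ α h = fun v =>
      (v.1, (-(v.2.2 / c₀) * rangeDeriv₁ α h v.2.1 v.1,
        -(v.2.2 / c₀) * rangeDeriv₂ α h v.2.1 v.1)) := by
    ext v <;> simp [rightCoordinates_apply, piR, parametrization_eq, groundCovector, covector_apply]
  have h2 := (hasFDerivAt_fst (𝕜 := ℝ) (p := v)).prodMk
    ((hasFDerivAt_momentum₁ (c₀ := c₀) (α := α) hh v).prodMk
      (hasFDerivAt_momentum₂ (c₀ := c₀) (α := α) hh v))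
  rw [← ContinuousLinearEquiv.comp_fderiv, h1]
  exact h2.fderiv

lemma fderiv_piL_eq_zero_iff (hh : 0 < h) (v w : (ℝ × ℝ) × (ℝ × ℝ)) :
    fderiv ℝ (piL c₀ α h) v w = 0 ↔
      timeDifferential c₀ α h v w = 0 ∧ momentumDifferential₁ c₀ α h v w = 0 ∧ w.2 = 0 := by
  have h1 := congrArg (fun l => l w) (leftCoordinates_comp_fderiv_piL (c₀ := c₀) (α := α) hh v)
  rw [← leftCoordinates.map_eq_zero_iff]
  change leftCoordinates (fderiv ℝ (piL c₀ α h) v w) = _ at h1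
  rw [h1]
  simp [Prod.ext_iff, and_assoc]

lemma fderiv_piR_eq_zero_iff (hh : 0 < h) (v w : (ℝ × ℝ) × (ℝ × ℝ)) :
    fderiv ℝ (piR c₀ α h) v w = 0 ↔
      w.1 = 0 ∧ momentumDifferential₁ c₀ α h v w = 0 ∧ momentumDifferential₂ c₀ α h v w = 0 := by
  have h1 := congrArg (fun l => l w) (rightCoordinates_comp_fderiv_piR (c₀ := c₀) (α := α) hh v)
  rw [← rightCoordinates.map_eq_zero_iff]
  change rightCoordinates (fderiv ℝ (piR c₀ α h) v w) = _ at h1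
  rw [h1]
  simp [Prod.ext_iff, and_assoc]

/-- The smooth nonvanishing factor of the Jacobian determinants of the projections. -/
def determinantFactor (c₀ α h : ℝ) (v : (ℝ × ℝ) × (ℝ × ℝ)) : ℝ :=
  -(v.2.2 / c₀ ^ 2) * jacobianFactor α h v.2.1 v.1

lemma rangeDeriv₂_eq (s : ℝ) (x : ℝ × ℝ) :
    rangeDeriv₂ α h s x = x.2 * ((dT α h s x)⁻¹ + (dR α h s x)⁻¹) := by
  rw [rangeDeriv₂]
  ring

/-- The components `(s, -ω)` do not depend on `x`. Their block has determinant `-1`, and the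
remaining block is the Jacobian of `(t, σ)` in `x`, divisible by `x₂`. -/
lemma det_piL (hh : 0 < h) (v : (ℝ × ℝ) × (ℝ × ℝ)) :
    ((leftCoordinates : _ →L[ℝ] (ℝ × ℝ) × (ℝ × ℝ)).comp (fderiv ℝ (piL c₀ α h) v)).det =
      determinantFactor c₀ α h v * coordX₂ v := by
  rw [leftCoordinates_comp_fderiv_piL hh, det_of_block_upper _ fun w => by simp]
  simp [timeDifferential_apply, momentumDifferential₁_apply, determinantFactor, jacobianFactor,
    rangeDeriv₂_eq]
  ring

/-- The base block is the identity, so only the Jacobian of `(ξ₁, ξ₂)` in `(s, ω)` remains. -/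
lemma det_piR (hh : 0 < h) (v : (ℝ × ℝ) × (ℝ × ℝ)) :
    ((rightCoordinates : _ →L[ℝ] (ℝ × ℝ) × (ℝ × ℝ)).comp (fderiv ℝ (piR c₀ α h) v)).det =
      determinantFactor c₀ α h v * coordX₂ v := by
  rw [rightCoordinates_comp_fderiv_piR hh, det_of_block_lower _ fun w => by simp]
  simp [momentumDifferential₁_apply, momentumDifferential₂_apply, determinantFactor,
    jacobianFactor, rangeDeriv₂_eq]
  ring

lemma differentiable_determinantFactor (hh : 0 < h) :
    Differentiable ℝ (determinantFactor c₀ α h) := by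
  have hT : Differentiable ℝ fun v : (ℝ × ℝ) × (ℝ × ℝ) => dT α h v.2.1 v.1 := fun v =>
    (hasFDerivAt_dT_coord hh v).differentiableAt
  have hR : Differentiable ℝ fun v : (ℝ × ℝ) × (ℝ × ℝ) => dR α h v.2.1 v.1 := fun v =>
    (hasFDerivAt_dR_coord hh v).differentiableAt
  have hTi : Differentiable ℝ fun v : (ℝ × ℝ) × (ℝ × ℝ) => (dT α h v.2.1 v.1)⁻¹ :=
    hT.inv fun v => (dT_pos hh _ _).ne'
  have hRi : Differentiable ℝ fun v : (ℝ × ℝ) × (ℝ × ℝ) => (dR α h v.2.1 v.1)⁻¹ :=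
    hR.inv fun v => (dR_pos hh _ _).ne'
  unfold determinantFactor jacobianFactor rangeDeriv₁ rangeHess₁₂ rangeHess₁₁
  simp only [div_eq_mul_inv, ← inv_pow]
  fun_prop

lemma determinantFactor_ne_zero (hc₀ : 0 < c₀) (hα : 0 < α) (hh : 0 < h) {v : (ℝ × ℝ) × (ℝ × ℝ)}
    (hv : v.2.2 ≠ 0) : determinantFactor c₀ α h v ≠ 0 :=
  mul_ne_zero (neg_ne_zero.2 (div_ne_zero hv (pow_ne_zero 2 hc₀.ne')))
    (jacobianFactor_pos hα hh _ _).ne'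

lemma rangeHess₁₁_pos (hh : 0 < h) (s : ℝ) (x : ℝ × ℝ) : 0 < rangeHess₁₁ α h s x := by
  have hT := dT_pos (α := α) hh s x
  have hR := dR_pos (α := α) hh s x
  rw [rangeHess₁₁]
  positivity

lemma coordX₂_ne_zero : coordX₂ ≠ 0 := by
  intro h1
  have h2 := congrArg (fun l => l ((0, 1), 0)) h1
  simp at h2

lemma isLocalDefiningFunction_coordX₂ (hh : 0 < h) {D : Opens (ℝ × ℝ)} {u : (ℝ × ℝ) × (ℝ × ℝ)}
    (hu : u ∈ parameterDomain c₀ α h D) :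
    IsLocalDefiningFunction coordX₂ (singularSet c₀ α h D) u := by
  refine ⟨parameterDomain c₀ α h D, isOpen_parameterDomain hh D, hu, coordX₂.contDiff.contDiffOn,
    ?_, ?_⟩
  · rw [ContinuousLinearMap.fderiv]
    exact coordX₂_ne_zero
  · ext w
    exact ⟨fun hw => ⟨hw.2, hw.1.2⟩, fun hw => ⟨⟨hw.1, hw.2⟩, hw.1⟩⟩

theorem isWhitneyFold_piL (hc₀ : 0 < c₀) (hα : 0 < α) (hh : 0 < h) (D : Opens (ℝ × ℝ)) :
    IsWhitneyFold (piL c₀ α h) (parameterDomain c₀ α h D) (singularSet c₀ α h D) := by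
  refine ⟨isOpen_parameterDomain hh D, fun _ hu => hu.1, (contDiff_piL hh).contDiffOn,
    fun u hu => ?_, fun u hu => ?_⟩
  · refine isLocalDiffeomorphAt_of_det_ne_zero (contDiff_piL hh) leftCoordinates ?_
    rw [det_piL hh]
    exact mul_ne_zero (determinantFactor_ne_zero hc₀ hα hh hu.1.2) fun h0 => hu.2 ⟨hu.1, h0⟩
  · have hx : u.1.2 = 0 := hu.2
    -- The kernel direction is `∂_{x₂}`: where `x₂ = 0`, the `x₂`-derivatives of `t` and `σ` vanish.
    -- It is transverse to `{x₂ = 0}`.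
    have hk : ((((0 : ℝ), (1 : ℝ)), ((0 : ℝ), (0 : ℝ)))) ∈
        LinearMap.ker (fderiv ℝ (piL c₀ α h) u).toLinearMap := by
      rw [LinearMap.mem_ker, ContinuousLinearMap.coe_coe, fderiv_piL_eq_zero_iff hh]
      simp [timeDifferential_apply, momentumDifferential₁_apply, rangeDeriv₂_eq, hx]
    refine ⟨dropsRankSimplyByOne_of_det_eq leftCoordinates (det_piL hh)
      (differentiable_determinantFactor hh u) (determinantFactor_ne_zero hc₀ hα hh hu.1.2) hx
      coordX₂_ne_zero (k := ((0, 1), (0, 0))) (by simp) (le_antisymm ?_ ?_), coordX₂,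
      isLocalDefiningFunction_coordX₂ hh hu.1, fun hle => ?_⟩
    · intro w hw
      rw [LinearMap.mem_ker, ContinuousLinearMap.coe_coe, fderiv_piL_eq_zero_iff hh,
        momentumDifferential₁_apply] at hw
      obtain ⟨-, h1, h2⟩ := hw
      have h3 := (rangeHess₁₁_pos (α := α) hh u.2.1 u.1).ne'
      have h4 : u.2.2 ≠ 0 := hu.1.2
      simp [h2, hx, hc₀.ne', h3, h4] at h1
      rw [Submodule.mem_span_singleton]
      refine ⟨w.1.2, ?_⟩
      ext <;> simp [h1, h2]
    · rwa [Submodule.span_singleton_le_iff_mem]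
    · have := hle hk
      rw [LinearMap.mem_ker, ContinuousLinearMap.coe_coe, ContinuousLinearMap.fderiv] at this
      simp at this

end Projections

/-! ### Fibres, Hessian and blow-down of `π_R`. -/

section BlowDown

variable {c₀ α h : ℝ}

lemma covector_eq_covector_iff {a b a' b' : ℝ} :
    covector a b = covector a' b' ↔ a = a' ∧ b = b' := by
  refine ⟨fun h1 => ?_, fun h1 => by rw [h1.1, h1.2]⟩
  have h2 := congrArg (fun l => l (1, 0)) h1
  have h3 := congrArg (fun l => l (0, 1)) h1
  simpa [covector_apply] using And.intro h2 h3

/-- Over `x₂ = 0` the component `ξ₂` is zero, so the fibre is cut out by the single quantity `ω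
∂r/∂x₁`, with `r = d_T + d_R`. -/
lemma piR_eq_piR_iff_of_snd_eq_zero {u w : (ℝ × ℝ) × (ℝ × ℝ)} (hu : u.1.2 = 0)
    (hc₀ : c₀ ≠ 0) :
    piR c₀ α h w = piR c₀ α h u ↔ w.1 = u.1 ∧
      w.2.2 * rangeDeriv₁ α h w.2.1 w.1 = u.2.2 * rangeDeriv₁ α h u.2.1 u.1 := by
  have e : ∀ v, piR c₀ α h v = (v.1, groundCovector c₀ α h v.2.2 v.2.1 v.1) := fun v => rfl
  rw [e, e, Prod.mk.injEq, groundCovector, groundCovector, covector_eq_covector_iff]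
  have h1 : ∀ a b c d : ℝ, -(a / c₀) * b = -(c / c₀) * d ↔ a * b = c * d := by
    intro a b c d
    constructor
    · intro h
      field_simp at h
      linarith
    · intro h
      field_simp
      linarith
  rw [h1]
  refine and_congr_right fun h2 => and_iff_left ?_
  rw [rangeDeriv₂_eq, rangeDeriv₂_eq, h2, hu]
  simp

lemma isEmbeddedSubmanifold_of_isSmoothParametrization {M F : Type*} [NormedAddCommGroup M]
    [NormedSpace ℝ M] [NormedAddCommGroup F] [NormedSpace ℝ F] {g : M → F} {U : Set M}
    {S : Set F} (hg : IsSmoothParametrization g U S) : IsEmbeddedSubmanifold M S :=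
  fun _ _ => ⟨univ, U, g, isOpen_univ, mem_univ _, by rwa [inter_univ]⟩

lemma isEmbeddedSubmanifold_fibre_piR (hc₀ : 0 < c₀) (hh : 0 < h) {D : Opens (ℝ × ℝ)}
    {u : (ℝ × ℝ) × (ℝ × ℝ)} (hu : u ∈ singularSet c₀ α h D) :
    IsEmbeddedSubmanifold ℝ {w ∈ singularSet c₀ α h D | piR c₀ α h w = piR c₀ α h u} := by
  obtain ⟨⟨⟨x₁, x₂⟩, ⟨s, w⟩⟩, rfl⟩ : ∃ u' : (ℝ × ℝ) × (ℝ × ℝ), u' = u := ⟨u, rfl⟩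
  obtain rfl : x₂ = 0 := hu.2
  have hw : w ≠ 0 := hu.1.2
  have hdom := isOpen_parameterDomain (c₀ := c₀) (α := α) hh D
  have hG : ContDiff ℝ ∞ fun s' : ℝ => rangeDeriv₁ α h s' ((x₁, 0) : ℝ × ℝ) :=
    contDiff_rangeDeriv₁ hh contDiff_id contDiff_const
  -- If `∂r/∂x₁` vanishes at `u`, the fibre consists of the points with `s = x₁` and is parametrized
  -- by `ω`.
  by_cases hs : x₁ = s
  · subst hs
    have hG0 : rangeDeriv₁ α h x₁ ((x₁, 0) : ℝ × ℝ) = 0 := (rangeDeriv₁_eq_zero_iff hh).2 rfl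
    have hg : ContDiff ℝ ∞ fun w' : ℝ => (((x₁, (0 : ℝ)), (x₁, w')) : (ℝ × ℝ) × (ℝ × ℝ)) :=
      contDiff_const.prodMk (contDiff_const.prodMk contDiff_id)
    refine isEmbeddedSubmanifold_of_isSmoothParametrization
      (g := fun w' : ℝ => (((x₁, 0), (x₁, w')) : (ℝ × ℝ) × (ℝ × ℝ)))
      (U := (fun w' : ℝ => (((x₁, 0), (x₁, w')) : (ℝ × ℝ) × (ℝ × ℝ))) ⁻¹'
        parameterDomain c₀ α h D)
      ⟨hdom.preimage hg.continuous, hg.contDiffOn, ?_, univ, fun v => v.2.2, isOpen_univ,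
        subset_univ _, contDiff_snd.snd.contDiffOn, fun _ _ => rfl⟩
    ext ⟨⟨y₁, y₂⟩, ⟨s', w'⟩⟩
    rw [mem_ofPred_eq, piR_eq_piR_iff_of_snd_eq_zero rfl hc₀.ne']
    dsimp only
    rw [hG0]
    constructor
    · rintro ⟨w'', h1, h2⟩
      simp only [Prod.mk.injEq] at h2
      obtain ⟨⟨rfl, rfl⟩, rfl, rfl⟩ := h2
      exact ⟨⟨h1, rfl⟩, rfl, by rw [hG0]; simp⟩
    · rintro ⟨⟨h1, h2⟩, h3, h4⟩
      simp only [Prod.mk.injEq] at h3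
      obtain ⟨rfl, rfl⟩ := h3
      have h5 : w' ≠ 0 := h1.2
      rw [mul_zero] at h4
      have h6 := (mul_eq_zero.1 h4).resolve_left h5
      obtain rfl := (rangeDeriv₁_eq_zero_iff hh).1 h6
      exact ⟨w', h1, rfl⟩
  -- Otherwise `k = ω G(s)` is a nonzero constant on the fibre, which is the graph `ω = k / G(s)`
  -- over the open set `G ≠ 0`.
  · set G : ℝ → ℝ := fun s' => rangeDeriv₁ α h s' ((x₁, 0) : ℝ × ℝ) with hGdef
    have hGne : ∀ s', G s' ≠ 0 ↔ x₁ ≠ s' := fun s' => (rangeDeriv₁_eq_zero_iff hh).not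
    set k : ℝ := w * G s with hk
    have hk0 : k ≠ 0 := mul_ne_zero hw ((hGne s).2 hs)
    let O : Set ℝ := {s' | G s' ≠ 0}
    have hO : IsOpen O := isOpen_ne_fun hG.continuous continuous_const
    let g : ℝ → (ℝ × ℝ) × (ℝ × ℝ) := fun s' => ((x₁, 0), (s', k / G s'))
    have hg : ContDiffOn ℝ ∞ g O := contDiffOn_const.prodMk
      (contDiffOn_id.prodMk (contDiffOn_const.div hG.contDiffOn fun s' hs' => hs'))
    refine isEmbeddedSubmanifold_of_isSmoothParametrization (g := g)
      (U := O ∩ g ⁻¹' parameterDomain c₀ α h D)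
      ⟨hg.continuousOn.isOpen_inter_preimage hO hdom, hg.mono inter_subset_left, ?_, univ,
        fun v => v.2.1, isOpen_univ, subset_univ _, contDiff_snd.fst.contDiffOn, fun _ _ => rfl⟩
    ext ⟨⟨y₁, y₂⟩, ⟨s', w'⟩⟩
    rw [mem_ofPred_eq, piR_eq_piR_iff_of_snd_eq_zero rfl hc₀.ne']
    constructor
    · rintro ⟨s'', ⟨h1, h2⟩, h3⟩
      rw [← h3]
      exact ⟨⟨h2, rfl⟩, rfl, div_mul_cancel₀ k h1⟩
    · rintro ⟨⟨h1, h2⟩, h3, h4⟩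
      simp only [Prod.mk.injEq] at h3
      obtain ⟨rfl, rfl⟩ := h3
      have h4' : w' * G s' = k := h4
      have h5 : G s' ≠ 0 := fun h0 => hk0 (by rw [← h4', h0, mul_zero])
      have h6 : g s' = ((y₁, 0), (s', w')) := by
        simp only [g, ← h4', mul_div_cancel_right₀ w' h5]
      refine ⟨s', ⟨h5, ?_⟩, h6⟩
      rw [mem_preimage, h6]
      exact h1

/-- Reduces the second derivative in a direction `v` to differentiation along a line, so that any
component of the first derivative constant there contributes zero. -/
lemma hasDerivAt_clm_line {M F G : Type*} [NormedAddCommGroup M] [NormedSpace ℝ M]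
    [NormedAddCommGroup F] [NormedSpace ℝ F] [NormedAddCommGroup G] [NormedSpace ℝ G]
    {A : M → M →L[ℝ] F} {u : M} (hA : DifferentiableAt ℝ A u) (L : F →L[ℝ] G) (v : M) :
    HasDerivAt (fun r : ℝ => L (A (u + r • v) v)) (L (fderiv ℝ A u v v)) 0 := by
  have h1 : HasDerivAt (fun r : ℝ => u + r • v) v 0 := by
    simpa using ((hasDerivAt_id (0 : ℝ)).smul_const v).const_add u
  have h2 : HasFDerivAt A (fderiv ℝ A u) (u + (0 : ℝ) • v) := by
    rw [zero_smul, add_zero]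
    exact hA.hasFDerivAt
  let B : (M →L[ℝ] F) →L[ℝ] G := L.comp (ContinuousLinearMap.apply ℝ F v)
  exact B.hasFDerivAt.comp_hasDerivAt (0 : ℝ) (h2.comp_hasDerivAt (0 : ℝ) h1)

/-- A kernel vector has no `x`-component, so the line `u + r v` stays in `x₂ = 0`. Along it only the
`ξ₁`-component of `dπ_R v` can be nonzero, hence the second derivative is a multiple of `∂_{ξ₁}`, a
direction in the range. -/
lemma hessian_piR_mem_range (hc₀ : 0 < c₀) (hh : 0 < h) {u v : (ℝ × ℝ) × (ℝ × ℝ)}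
    (hx : u.1.2 = 0) (hw : u.2.2 ≠ 0) (hv : fderiv ℝ (piR c₀ α h) u v = 0) :
    fderiv ℝ (fderiv ℝ (piR c₀ α h)) u v v ∈ range (fderiv ℝ (piR c₀ α h) u) := by
  have hv1 : v.1 = 0 := ((fderiv_piR_eq_zero_iff hh u v).1 hv).1
  have hcomp : ∀ p w, rightCoordinates (fderiv ℝ (piR c₀ α h) p w) =
      (w.1, (momentumDifferential₁ c₀ α h p w, momentumDifferential₂ c₀ α h p w)) := fun p w =>
    congrArg (fun l => l w) (rightCoordinates_comp_fderiv_piR (c₀ := c₀) (α := α) hh p)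
  have hline : ∀ r : ℝ, rightCoordinates (fderiv ℝ (piR c₀ α h) (u + r • v) v) =
      (0, (momentumDifferential₁ c₀ α h (u + r • v) v, 0)) := by
    intro r
    rw [hcomp, hv1, momentumDifferential₂_apply, rangeDeriv₂_eq]
    simp [hv1, hx]
  have hd : DifferentiableAt ℝ (fderiv ℝ (piR c₀ α h)) u :=
    ((contDiff_piR hh).fderiv_right (m := ∞) (by simp)).differentiable (by simp) u
  set q := rightCoordinates (fderiv ℝ (fderiv ℝ (piR c₀ α h)) u v v) with hq
  have hq1 : q.1 = 0 := by
    have h1 := hasDerivAt_clm_line hd ((ContinuousLinearMap.fst ℝ (ℝ × ℝ) (ℝ × ℝ)).comp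
      (rightCoordinates : _ →L[ℝ] (ℝ × ℝ) × (ℝ × ℝ))) v
    simp only [ContinuousLinearMap.comp_apply, ContinuousLinearEquiv.coe_coe, hline,
      ContinuousLinearMap.coe_fst'] at h1
    exact HasDerivAt.unique h1 (hasDerivAt_const _ _)
  have hq2 : q.2.2 = 0 := by
    have h1 := hasDerivAt_clm_line hd ((ContinuousLinearMap.snd ℝ ℝ ℝ).comp
      ((ContinuousLinearMap.snd ℝ (ℝ × ℝ) (ℝ × ℝ)).comp
        (rightCoordinates : _ →L[ℝ] (ℝ × ℝ) × (ℝ × ℝ)))) v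
    simp only [ContinuousLinearMap.comp_apply, ContinuousLinearEquiv.coe_coe, hline,
      ContinuousLinearMap.coe_snd'] at h1
    exact HasDerivAt.unique h1 (hasDerivAt_const _ _)
  have hP := (rangeHess₁₁_pos (α := α) hh u.2.1 u.1).ne'
  -- A multiple of `∂_s`, whose image on `Σ` is `(ω/c₀) ∂²r/∂x₁²` in the `ξ₁`-direction, with `r =
  -- d_T + d_R`.
  refine ⟨(0, (q.2.1 / (1 / c₀ * (u.2.2 * rangeHess₁₁ α h u.2.1 u.1)), 0)), ?_⟩
  apply rightCoordinates.injective
  rw [hcomp, ← hq, momentumDifferential₁_apply, momentumDifferential₂_apply]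
  refine Prod.ext (by simp [hq1]) (Prod.ext ?_ (by simp [hx, hq2]))
  simp
  field_simp

theorem isBlowDown_piR (hc₀ : 0 < c₀) (hα : 0 < α) (hh : 0 < h) (D : Opens (ℝ × ℝ)) :
    IsBlowDown (piR c₀ α h) (parameterDomain c₀ α h D) (singularSet c₀ α h D) := by
  refine ⟨isOpen_parameterDomain hh D, fun _ hu => hu.1, (contDiff_piR hh).contDiffOn,
    fun u hu => ?_, fun u hu => ⟨?_, fun v hv => hessian_piR_mem_range hc₀ hh hu.2 hu.1.2 hv,
      ⟨coordX₂, isLocalDefiningFunction_coordX₂ hh hu.1, ?_⟩,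
      isEmbeddedSubmanifold_fibre_piR hc₀ hh hu⟩⟩
  · refine isLocalDiffeomorphAt_of_det_ne_zero (contDiff_piR hh) rightCoordinates ?_
    rw [det_piR hh]
    exact mul_ne_zero (determinantFactor_ne_zero hc₀ hα hh hu.1.2) fun h0 => hu.2 ⟨hu.1, h0⟩
  · have hx : u.1.2 = 0 := hu.2
    have hw : u.2.2 ≠ 0 := hu.1.2
    have hP := (rangeHess₁₁_pos (α := α) hh u.2.1 u.1).ne'
    refine dropsRankSimplyByOne_of_det_eq rightCoordinates (det_piR hh)
      (differentiable_determinantFactor hh u) (determinantFactor_ne_zero hc₀ hα hh hw) hx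
      coordX₂_ne_zero
      -- The kernel is found from `dξ₁ = 0` within the `(s, ω)` plane, as `dξ₂` vanishes there; its
      -- `ω`-component is nonzero.
      (k := (0, (rangeDeriv₁ α h u.2.1 u.1, u.2.2 * rangeHess₁₁ α h u.2.1 u.1)))
      (fun h0 => mul_ne_zero hw hP (congrArg (fun p => p.2.2) h0)) (le_antisymm ?_ ?_)
    · intro w h1
      rw [LinearMap.mem_ker, ContinuousLinearMap.coe_coe, fderiv_piR_eq_zero_iff hh,
        momentumDifferential₁_apply] at h1
      obtain ⟨h1, h2, -⟩ := h1
      have h3 : rangeDeriv₁ α h u.2.1 u.1 * w.2.2 =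
          u.2.2 * rangeHess₁₁ α h u.2.1 u.1 * w.2.1 := by
        have := (mul_eq_zero.1 h2).resolve_left (by simp [hc₀.ne'])
        rw [h1] at this
        simp only [Prod.fst_zero, Prod.snd_zero] at this
        linarith
      rw [Submodule.mem_span_singleton]
      refine ⟨w.2.2 / (u.2.2 * rangeHess₁₁ α h u.2.1 u.1), ?_⟩
      refine Prod.ext (by simp [h1]) (Prod.ext ?_ ?_)
      · simp only [Prod.smul_mk, smul_eq_mul]
        field_simp
        linarith
      · simp only [Prod.smul_mk, smul_eq_mul]
        field_simp
    · rw [Submodule.span_singleton_le_iff_mem, LinearMap.mem_ker, ContinuousLinearMap.coe_coe,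
        fderiv_piR_eq_zero_iff hh, momentumDifferential₁_apply, momentumDifferential₂_apply,
        rangeDeriv₂_eq, hx]
      refine ⟨rfl, ?_, by simp⟩
      simp only [Prod.fst_zero, Prod.snd_zero]
      ring
  · intro w hw
    rw [LinearMap.mem_ker, ContinuousLinearMap.coe_coe, fderiv_piR_eq_zero_iff hh] at hw
    rw [LinearMap.mem_ker, ContinuousLinearMap.coe_coe, ContinuousLinearMap.fderiv]
    simp [hw.1]

end BlowDown

end BistaticSAR

end

open BistaticSAR in
theorem theorem1 (c₀ α h : ℝ) (hc₀ : 0 < c₀) (hα : 0 < α) (hh : 0 < h)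
    (s₀ s₁ t₀ t₁ : EReal)
    (A : ((ℝ × ℝ) × (ℝ × ℝ)) × ℝ → ℂ) (hA : IsAmplitude c₀ α h s₀ s₁ t₀ t₁ A) :
    (∃ F : 𝓓((⊤ : Opens (ℝ × ℝ)), ℝ) →ₗ[ℝ] 𝓓'(dataSpace s₀ s₁ t₀ t₁, ℂ),
      IsForwardOperator c₀ α h A (dataSpace s₀ s₁ t₀ t₁) F ∧
      IsFourierIntegralOperator (3 / 2) (dataSpace s₀ s₁ t₀ t₁) ⊤
        (canonicalRelation c₀ α h (dataSpace s₀ s₁ t₀ t₁)) F) ∧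
    (∃ F : 𝓓((⊤ : Opens (ℝ × ℝ)), ℝ) →ₗ[ℝ] 𝓓'(excisedDataSpace c₀ α h s₀ s₁ t₀ t₁, ℂ),
      IsForwardOperator c₀ α h A (excisedDataSpace c₀ α h s₀ s₁ t₀ t₁) F ∧
      IsFourierIntegralOperator (3 / 2) (excisedDataSpace c₀ α h s₀ s₁ t₀ t₁) ⊤
        (canonicalRelation c₀ α h (excisedDataSpace c₀ α h s₀ s₁ t₀ t₁)) F) ∧
    IsHomogeneousCanonicalRelation (excisedDataSpace c₀ α h s₀ s₁ t₀ t₁) ⊤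
      (canonicalRelation c₀ α h (excisedDataSpace c₀ α h s₀ s₁ t₀ t₁)) ∧
    IsSmoothParametrization (parametrization c₀ α h)
      (parameterDomain c₀ α h (dataSpace s₀ s₁ t₀ t₁))
      (canonicalRelation c₀ α h (dataSpace s₀ s₁ t₀ t₁)) ∧
    IsWhitneyFold (piL c₀ α h) (parameterDomain c₀ α h (dataSpace s₀ s₁ t₀ t₁))
      (singularSet c₀ α h (dataSpace s₀ s₁ t₀ t₁)) ∧
    IsBlowDown (piR c₀ α h) (parameterDomain c₀ α h (dataSpace s₀ s₁ t₀ t₁))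
      (singularSet c₀ α h (dataSpace s₀ s₁ t₀ t₁)) := by
  have hA₀ := hA.symbol.mono (Ω' := prodOpens (excisedDataSpace c₀ α h s₀ s₁ t₀ t₁) ⊤)
    (Set.prod_mono (inf_le_left : excisedDataSpace c₀ α h s₀ s₁ t₀ t₁ ≤ _) Set.Subset.rfl)
  exact ⟨exists_forwardOperator hc₀ hh hA.symbol, exists_forwardOperator hc₀ hh hA₀,
    isHomogeneousCanonicalRelation_excised hc₀ hh,
    isSmoothParametrization_parametrization hc₀ hh _, isWhitneyFold_piL hc₀ hα hh _,
    isBlowDown_piR hc₀ hα hh _⟩
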